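/- **Setting.** A weighted graph $(E,\omega)$ consists of countable sets $E^0$ (vertices) and $E^{\mathrm{st}}$ (structured edges), maps $s,r:E^{\mathrm{st}}\to E^0$ and a weight map $\omega:E^{\mathrm{st}}\to\{1,2,3,\dots\}$. Its edge set is $E^1=\bigsqcup_{\alpha\in E^{\mathrm{st}}}\{\alpha_1,\dots,\alpha_{\omega(\alpha)}\}$. It is row-finite if $s^{-1}(v)$ is finite for every $v\in E^0$; it is unweighted if $\omega=1$, and then $E^1$ is identified with $E^{\mathrm{st}}$. Let $R$ be a (not necessarily commutative) unital ring. The weighted Leavitt path algebra $L_R(E,\omega)$ is the quotient of the free non-unital $R$-ring on $E^0\cup E^1\cup (E^1)^*$ (the free left $R$-module on the nonempty words, with $(aw)(bw')=(ab)(ww')$ for $a,b\in R$) by the ideal (two-sided ideal and $R$-subbimodule) generated by the relations 1. $vw=\delta_{vw}v$ for $v,w\in E^0$; 2. $s(\alpha)\alpha_i=\alpha_i=\alpha_i r(\alpha)$ and $r(\alpha)\alpha_i^*=\alpha_i^*=\alpha_i^*s(\alpha)$ for $\alpha\in E^{\mathrm{st}}$, $1\le i\le\omega(\alpha)$; 3.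 $\sum_{s(\alpha)=v}\alpha_i\alpha_j^*=\delta_{ij}v$ for every $v\in E^0$ with $s^{-1}(v)$ finite and $1\le i,j\le\max\{\omega(\alpha): s(\alpha)=v\}$ (no relation if $v$ is a sink); 4. $\sum_{1\le i\le\max\{\omega(\alpha),\omega(\beta)\}}\alpha_i^*\beta_i=\delta_{\alpha\beta}r(\alpha)$ for $\alpha,\beta\in E^{\mathrm{st}}$; where $\alpha_i=\alpha_i^*=0$ for $i>\omega(\alpha)$. For an unweighted graph $F$, $L_R(F)=L_R(F,1)$ is the (ordinary) Leavitt path algebra of $F$. A ring is simple if it is nonzero and its only two-sided ideals are $0$ and itself. A vertex is weighted if it emits a structured edge of weight $>1$. The weight forest $\overline{E^0_\omega}$ is the set of all vertices that can be reached by a (possibly trivial) directed path from a weighted vertex. $(E,\omega)$ is reducible if $|s^{-1}(v)|\le 1$ and $|r^{-1}(v)\cap s^{-1}(\overline{E^0_\omega})|\le 1$ (counting structured edges) for every $v\in\overline{E^0_\omega}$; in particular it is reducible if no vertex is weighted. The unweighted graph $F$ associated with $(E,\omega)$ has $F^0=E^0$ and one edge $e_{\alpha_i}$ for each $\alpha_i\in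 E^1$, running from $s(\alpha)$ to $r(\alpha)$ if $s(\alpha)\notin\overline{E^0_\omega}$, and from $r(\alpha)$ to $s(\alpha)$ if $s(\alpha)\in\overline{E^0_\omega}$. **Theorem (Simplicity Theorem).** Let $R$ be a unital ring and $(E,\omega)$ a row-finite weighted graph, with associated unweighted graph $F$. Then $L_R(E,\omega)$ is simple if and only if $(E,\omega)$ is reducible and $L_R(F)$ is simple. Moreover, if $L_R(E,\omega)$ is simple, then $F$ is row-finite and $L_R(E,\omega)\cong L_R(F)$ as $R$-rings (by a ring isomorphism that is left and right $R$-linear); so every simple weighted Leavitt path algebra of a row-finite weighted graph is isomorphic to an ordinary Leavitt path algebra of a row-finite graph. -/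

import Mathlib

/-- A weighted graph with vertex set `V` and set of structured edges `S`: source and range maps and
a weight map with positive values. -/
structure WeightedGraph (V : Type*) (S : Type*) where
  source : S → V
  range : S → V
  weight : S → ℕ
  weight_pos : ∀ α, 0 < weight α

/-- A directed (unweighted) graph with vertex set `V` and edge set `A`. -/
structure DirectedGraph (V : Type*) (A : Type*) where
  source : A → V
  range : A → V

/-- An unweighted graph is regarded as a weighted graph with weight map constantly `1`. -/
def DirectedGraph.toWeightedGraph {V A : Type*} (F : DirectedGraph V A) : WeightedGraph V A where
  source := F.source
  range := F.range
  weight := fun _ => 1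
  weight_pos := fun _ => one_pos

namespace WeightedGraph

variable {V S : Type*}

/-- Every vertex emits only finitely many structured edges. -/
def RowFinite (E : WeightedGraph V S) : Prop :=
  ∀ v, {α | E.source α = v}.Finite

/-- The set of edges: the disjoint union over all structured edges `α` of the sets
`{α₁, …, α_k}` with `k = ω(α)`. The indices are shifted: `⟨α, i⟩` stands for `α_{i+1}`. -/
abbrev Edge (E : WeightedGraph V S) : Type _ := Σ α : S, Fin (E.weight α)

/-- `E.Reaches u v`: there is a path (of length `≥ 0`) from `u` to `v`. Since all weights are
positive, each structured edge carries at least one edge. -/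
def Reaches (E : WeightedGraph V S) (u v : V) : Prop :=
  Relation.ReflTransGen (fun a b => ∃ α, E.source α = a ∧ E.range α = b) u v

/-- A vertex is weighted if the maximal weight of the structured edges it emits is greater than
`1`, i.e. if it emits a structured edge of weight greater than `1`. -/
def IsWeightedVertex (E : WeightedGraph V S) (v : V) : Prop :=
  ∃ α, E.source α = v ∧ 1 < E.weight α

/-- The weight forest: all vertices which can be reached from a weighted vertex. -/
def weightForest (E : WeightedGraph V S) : Set V :=
  {v | ∃ u, E.IsWeightedVertex u ∧ E.Reaches u v}

/-- Reducibility: each vertex of the weight forest emits at most one structured edge, and receives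
at most one structured edge from the weight forest. -/
def Reducible (E : WeightedGraph V S) : Prop :=
  ∀ v ∈ E.weightForest,
    {α | E.source α = v}.Subsingleton ∧
    {α | E.range α = v ∧ E.source α ∈ E.weightForest}.Subsingleton

open Classical in
/-- The unweighted graph associated with a weighted graph: it has the same vertices and an edge
for each edge `α_i`, which is reversed if the source of `α` lies in the weight forest. -/
noncomputable def associatedGraph (E : WeightedGraph V S) : DirectedGraph V E.Edge where
  source := fun e => if E.source e.1 ∈ E.weightForest then E.range e.1 else E.source e.1
  range := fun e => if E.source e.1 ∈ E.weightForest then E.source e.1 else E.range e.1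

/-- The generating set `X = E⁰ ∪ E¹ ∪ (E¹)*`; indices are shifted by one. -/
inductive Generator (E : WeightedGraph V S) : Type _
  | vertex (v : V) : Generator E
  | edge (α : S) (i : Fin (E.weight α)) : Generator E
  | ghost (α : S) (i : Fin (E.weight α)) : Generator E

/-- The free (non-unital) `R`-ring generated by `X`: the free left `R`-module on the nonempty words
over `X`, with multiplication `(r w) (r' w') = (r r') (w w')`. -/
abbrev FreeRing (E : WeightedGraph V S) (R : Type*) [Ring R] : Type _ :=
  MonoidAlgebra R (FreeSemigroup E.Generator)

section Relations

variable (E : WeightedGraph V S) (R : Type*) [Ring R]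

/-- The vertex `v` as an element of the free `R`-ring. -/
noncomputable def vertexElt (v : V) : E.FreeRing R :=
  MonoidAlgebra.single (FreeSemigroup.of (Generator.vertex v)) 1

/-- The element `α_{i+1}` of the free `R`-ring, which is `0` if `i + 1 > ω(α)`. -/
noncomputable def edgeElt (α : S) (i : ℕ) : E.FreeRing R :=
  if h : i < E.weight α then
    MonoidAlgebra.single (FreeSemigroup.of (Generator.edge α ⟨i, h⟩)) 1 else 0

/-- The element `α_{i+1}^*` of the free `R`-ring, which is `0` if `i + 1 > ω(α)`. -/
noncomputable def ghostElt (α : S) (i : ℕ) : E.FreeRing R :=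
  if h : i < E.weight α then
    MonoidAlgebra.single (FreeSemigroup.of (Generator.ghost α ⟨i, h⟩)) 1 else 0

/-- The defining relations of the weighted Leavitt path algebra. In `sum_edge_ghost` the condition
on `i` says that `i + 1 ≤ max {ω(α) | s(α) = v}`, likewise for `j`. That relation is imposed at the
vertices which emit finitely many structured edges, hence at all vertices of a row-finite graph. -/
inductive LeavittRel : E.FreeRing R → E.FreeRing R → Prop
  | vertex_mul_self (v : V) :
      LeavittRel (E.vertexElt R v * E.vertexElt R v) (E.vertexElt R v)
  | vertex_mul_of_ne (v w : V) (h : v ≠ w) :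
      LeavittRel (E.vertexElt R v * E.vertexElt R w) 0
  | source_mul_edge (α : S) (i : ℕ) (h : i < E.weight α) :
      LeavittRel (E.vertexElt R (E.source α) * E.edgeElt R α i) (E.edgeElt R α i)
  | edge_mul_range (α : S) (i : ℕ) (h : i < E.weight α) :
      LeavittRel (E.edgeElt R α i * E.vertexElt R (E.range α)) (E.edgeElt R α i)
  | range_mul_ghost (α : S) (i : ℕ) (h : i < E.weight α) :
      LeavittRel (E.vertexElt R (E.range α) * E.ghostElt R α i) (E.ghostElt R α i)
  | ghost_mul_source (α : S) (i : ℕ) (h : i < E.weight α) :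
      LeavittRel (E.ghostElt R α i * E.vertexElt R (E.source α)) (E.ghostElt R α i)
  | sum_edge_ghost (v : V) (hv : {α | E.source α = v}.Finite) (i j : ℕ)
      (hi : ∃ α, E.source α = v ∧ i < E.weight α) (hj : ∃ α, E.source α = v ∧ j < E.weight α) :
      LeavittRel (∑ α ∈ hv.toFinset, E.edgeElt R α i * E.ghostElt R α j)
        (if i = j then E.vertexElt R v else 0)
  | sum_ghost_edge_self (α : S) :
      LeavittRel (∑ i ∈ Finset.range (E.weight α), E.ghostElt R α i * E.edgeElt R α i)
        (E.vertexElt R (E.range α))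
  | sum_ghost_edge_of_ne (α β : S) (h : α ≠ β) :
      LeavittRel (∑ i ∈ Finset.range (max (E.weight α) (E.weight β)),
        E.ghostElt R α i * E.edgeElt R β i) 0

end Relations

/-- An ideal of the free `R`-ring as an `R`-ring: a two-sided ideal which is an
`R`-subbimodule. -/
def IsRIdeal {R : Type*} [Ring R] {E : WeightedGraph V S}
    (J : TwoSidedIdeal (E.FreeRing R)) : Prop :=
  ∀ (a : R), ∀ x ∈ J, a • x ∈ J ∧ MulOpposite.op a • x ∈ J

/-- The ideal of the free `R`-ring generated by the defining relations. -/
noncomputable def leavittIdeal (E : WeightedGraph V S) (R : Type*) [Ring R] :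
    TwoSidedIdeal (E.FreeRing R) :=
  sInf {J | IsRIdeal J ∧ ∀ x y, E.LeavittRel R x y → x - y ∈ J}

theorem mem_leavittIdeal_iff {E : WeightedGraph V S} {R : Type*} [Ring R] {x : E.FreeRing R} :
    x ∈ E.leavittIdeal R ↔ ∀ J : TwoSidedIdeal (E.FreeRing R),
      IsRIdeal J → (∀ y z, E.LeavittRel R y z → y - z ∈ J) → x ∈ J := by
  simp [leavittIdeal, TwoSidedIdeal.mem_sInf]

theorem isRIdeal_leavittIdeal (E : WeightedGraph V S) (R : Type*) [Ring R] :
    IsRIdeal (E.leavittIdeal R) := by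
  intro a x hx
  rw [mem_leavittIdeal_iff] at hx
  constructor <;> rw [mem_leavittIdeal_iff] <;> intro J h1 h2
  · exact (h1 a x (hx J h1 h2)).1
  · exact (h1 a x (hx J h1 h2)).2

end WeightedGraph

/-- The weighted Leavitt path algebra `L_R(E, ω)`. -/
def WeightedLeavittPathAlgebra {V S : Type*} (R : Type*) [Ring R] (E : WeightedGraph V S) :
    Type _ :=
  (E.leavittIdeal R).ringCon.Quotient

namespace WeightedLeavittPathAlgebra

variable {V S : Type*} (R : Type*) [Ring R] (E : WeightedGraph V S)

noncomputable instance : NonUnitalRing (WeightedLeavittPathAlgebra R E) :=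
  inferInstanceAs (NonUnitalRing (E.leavittIdeal R).ringCon.Quotient)

/-- The quotient map from the free `R`-ring. -/
noncomputable def mk (x : E.FreeRing R) : WeightedLeavittPathAlgebra R E :=
  RingCon.toQuotient (c := (E.leavittIdeal R).ringCon) x

/-- The left and right actions of `R` on the weighted Leavitt path algebra, induced by those on the
free `R`-ring. -/
noncomputable instance : Module R (WeightedLeavittPathAlgebra R E) where
  smul a := Quotient.map' (fun x => a • x) (by
    intro x y h
    have h' : x - y ∈ E.leavittIdeal R := ((E.leavittIdeal R).rel_iff x y).1 h
    refine ((E.leavittIdeal R).rel_iff _ _).2 ?_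
    rw [← smul_sub]
    exact (E.isRIdeal_leavittIdeal R a _ h').1)
  one_smul := by rintro ⟨x⟩; exact congrArg (mk R E) (one_smul R x)
  mul_smul := by rintro a b ⟨x⟩; exact congrArg (mk R E) (mul_smul a b x)
  smul_zero := by intro a; exact congrArg (mk R E) (smul_zero a)
  smul_add := by rintro a ⟨x⟩ ⟨y⟩; exact congrArg (mk R E) (smul_add a x y)
  add_smul := by rintro a b ⟨x⟩; exact congrArg (mk R E) (add_smul a b x)
  zero_smul := by rintro ⟨x⟩; exact congrArg (mk R E) (zero_smul R x)

noncomputable instance : Module Rᵐᵒᵖ (WeightedLeavittPathAlgebra R E) where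
  smul a := Quotient.map' (fun x => a • x) (by
    intro x y h
    have h' : x - y ∈ E.leavittIdeal R := ((E.leavittIdeal R).rel_iff x y).1 h
    refine ((E.leavittIdeal R).rel_iff _ _).2 ?_
    rw [← smul_sub]
    exact (E.isRIdeal_leavittIdeal R a.unop _ h').2)
  one_smul := by rintro ⟨x⟩; exact congrArg (mk R E) (one_smul Rᵐᵒᵖ x)
  mul_smul := by rintro a b ⟨x⟩; exact congrArg (mk R E) (mul_smul a b x)
  smul_zero := by intro a; exact congrArg (mk R E) (smul_zero a)
  smul_add := by rintro a ⟨x⟩ ⟨y⟩; exact congrArg (mk R E) (smul_add a x y)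
  add_smul := by rintro a b ⟨x⟩; exact congrArg (mk R E) (add_smul a b x)
  zero_smul := by rintro ⟨x⟩; exact congrArg (mk R E) (zero_smul Rᵐᵒᵖ x)

end WeightedLeavittPathAlgebra

/-- The (ordinary) Leavitt path algebra `L_R(F)` of an unweighted graph. -/
abbrev LeavittPathAlgebra {V A : Type*} (R : Type*) [Ring R] (F : DirectedGraph V A) : Type _ :=
  WeightedLeavittPathAlgebra R F.toWeightedGraph

/-! ### Maps out of the quotient -/

namespace WeightedLeavittPathAlgebra

open WeightedGraph

section Basic

variable {V S : Type*} {R : Type*} [Ring R] {E : WeightedGraph V S}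

/-! Simplicity forces reducibility because the algebra has many representations that simplicity does
not allow to differ. A `BranchingSystem` makes it act on functions `V × ℕ → R` by partial bijections
of points: `α_{i+1}` relates `(s(α), n)` to `(r(α), k)` when `loc α k = (n, i)`. Every vertex acts
as a nonzero projection, so over a simple algebra no such representation has a nonzero kernel. Hence
no element can act as the empty projection in one branching system and as a nonempty projection in
another (`not_cuts_of_isSimpleRing`).

Weights produce proper subsets to which this applies. Start with the identity at a weighted vertex
and conjugate by `p₁^*` and `p₁` along a path whose vertices emit one structured edge each. The
result is a projection onto an infinite subset of the copy of `ℕ` at the end of the path, and after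
at least one step the subset is also co-infinite, because the pairs `(n, 1)` at the weighted vertex
are lost (`exists_cutsOff`). If the weight forest contains a vertex with two outgoing edges, stop at
the first one on a path from a weighted vertex: the local system there can still be chosen so that a
given edge meets the subset or misses it. If two forest edges `α`, `β` have the same range and
`s(α)` does not reach `s(β)`, both give subsets at the common range, and the one coming from `α` can
be permuted to equal, or to be complementary to, the one coming from `β`. So the two sources reach
each other; as each forest vertex emits at most one edge, they lie on one cycle, and a vertex on a
cycle has only one predecessor there, whence `α = β`.

Conversely, in a reducible graph exchanging `α_i` with `α_i^*` over the weight forest exchanges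
relations 3 and 4 there: `α_i α_j^* = δ_{ij} s(α)` becomes orthogonality of the edges of `F`, and `∑
α_i^* α_i = r(α)` becomes the summation relation of `F` at `r(α)`. This gives the isomorphism
(`exists_ringEquiv_of_reducible`), and simplicity is transferred along it. -/

theorem mk_surjective : Function.Surjective (mk R E) := by
  rintro ⟨x⟩
  exact ⟨x, rfl⟩

theorem mk_eq_mk_iff {x y : E.FreeRing R} : mk R E x = mk R E y ↔ x - y ∈ E.leavittIdeal R := by
  unfold mk
  rw [← TwoSidedIdeal.rel_iff]
  exact RingCon.eq _

theorem mk_mul (x y : E.FreeRing R) : mk R E (x * y) = mk R E x * mk R E y := rfl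

theorem mk_add (x y : E.FreeRing R) : mk R E (x + y) = mk R E x + mk R E y := rfl

theorem mk_zero : mk R E 0 = 0 := rfl

variable (R E) in
/-- The quotient map as a homomorphism of non-unital rings. -/
noncomputable def mkHom : E.FreeRing R →ₙ+* WeightedLeavittPathAlgebra R E where
  toFun := mk R E
  map_mul' := mk_mul
  map_zero' := mk_zero
  map_add' := mk_add

theorem mk_sum {ι : Type*} (s : Finset ι) (f : ι → E.FreeRing R) :
    mk R E (∑ i ∈ s, f i) = ∑ i ∈ s, mk R E (f i) :=
  map_sum (mkHom R E) f s

theorem mk_eq_of_rel {x y : E.FreeRing R} (h : E.LeavittRel R x y) : mk R E x = mk R E y := by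
  rw [mk_eq_mk_iff, mem_leavittIdeal_iff]
  exact fun J _ hJ => hJ x y h

/-- A homomorphism from the free `R`-ring whose kernel is an `R`-subbimodule and which respects the
defining relations vanishes on the defining ideal. -/
theorem eq_zero_of_mem_leavittIdeal {N : Type*} [NonUnitalRing N] (ψ : E.FreeRing R →ₙ+* N)
    (hψ : ∀ (a : R) x, ψ x = 0 → ψ (a • x) = 0 ∧ ψ (MulOpposite.op a • x) = 0)
    (hrel : ∀ x y, E.LeavittRel R x y → ψ x = ψ y) {x : E.FreeRing R}
    (hx : x ∈ E.leavittIdeal R) : ψ x = 0 := by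
  rw [mem_leavittIdeal_iff] at hx
  have := hx (TwoSidedIdeal.ker ψ)
    (by
      intro a y hy
      rw [TwoSidedIdeal.mem_ker] at hy
      simpa only [TwoSidedIdeal.mem_ker] using hψ a y hy)
    (by
      intro y z h
      rw [TwoSidedIdeal.mem_ker, map_sub, hrel y z h, sub_self])
  simpa only [TwoSidedIdeal.mem_ker] using this

/-- The homomorphism induced on the weighted Leavitt path algebra. -/
noncomputable def lift {N : Type*} [NonUnitalRing N] (ψ : E.FreeRing R →ₙ+* N)
    (hψ : ∀ (a : R) x, ψ x = 0 → ψ (a • x) = 0 ∧ ψ (MulOpposite.op a • x) = 0)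
    (hrel : ∀ x y, E.LeavittRel R x y → ψ x = ψ y) : WeightedLeavittPathAlgebra R E →ₙ+* N where
  toFun := Quotient.lift ψ (by
    intro x y h
    have h' : x - y ∈ E.leavittIdeal R := ((E.leavittIdeal R).rel_iff x y).1 h
    have := eq_zero_of_mem_leavittIdeal ψ hψ hrel h'
    rwa [map_sub, sub_eq_zero] at this)
  map_mul' := by rintro ⟨x⟩ ⟨y⟩; exact map_mul ψ x y
  map_zero' := map_zero ψ
  map_add' := by rintro ⟨x⟩ ⟨y⟩; exact map_add ψ x y

end Basic

end WeightedLeavittPathAlgebra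

/-! ### Branching systems and their representations -/

namespace WeightedGraph

variable {V S : Type*}

/-- A branching system of a weighted graph all of whose vertices are represented by copies of `ℕ`:
for every `v`, the maps `loc α` with `s(α) = v` form a bijection from the disjoint union of the
copies of `ℕ` at the ranges of these `α` onto the set of all pairs `(n, i)` such that `v` emits a
structured edge of weight greater than `i`, and the second component of `loc α k` is less than the
weight of `α`. -/
structure BranchingSystem (E : WeightedGraph V S) where
  loc : S → ℕ → ℕ × ℕ
  loc_lt : ∀ α k, (loc α k).2 < E.weight α
  loc_inj : ∀ α β k l, E.source α = E.source β → loc α k = loc β l → α = β ∧ k = l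
  loc_surj : ∀ α n i, i < E.weight α → ∃ β k, E.source β = E.source α ∧ loc β k = (n, i)

end WeightedGraph

section PartialMaps

variable (R : Type*) [Ring R] {X : Type*}

/-- The additive endomorphism of `X → R` given by pulling back along a partial map. -/
def pullback (t : X → Option X) : Module.End ℤ (X → R) where
  toFun m x := (t x).elim 0 m
  map_add' m m' := by funext x; simp only [Pi.add_apply]; cases t x <;> simp
  map_smul' n m := by funext x; simp only [Pi.smul_apply]; cases t x <;> simp

variable {R}

theorem pullback_apply (t : X → Option X) (m : X → R) (x : X) :
    pullback R t m x = (t x).elim 0 m := rfl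

/-- Pulling back only moves values between points, while scalars multiply the values from the left.
This lets the coefficients be moved past the words, so the representation is multiplicative although
`R` need not be commutative. -/
theorem commute_pullback (a : R) (t : X → Option X) :
    Commute (Module.toModuleEnd ℤ (S := R) (X → R) a) (pullback R t) := by
  refine LinearMap.ext fun m => funext fun x => ?_
  change a • (t x).elim 0 m = (t x).elim 0 (a • m)
  cases t x <;> simp

end PartialMaps

namespace WeightedGraph.BranchingSystem

open WeightedGraph

variable {V S : Type*} {E : WeightedGraph V S} (B : BranchingSystem E)

open Classical in
/-- The identity of the subset `Z` of the copy of `ℕ` at `v`. -/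
noncomputable def idStep (v : V) (Z : Set ℕ) (x : V × ℕ) : Option (V × ℕ) :=
  if x.1 = v ∧ x.2 ∈ Z then some x else none

open Classical in
/-- The partial map by which `α_{i+1}` acts. -/
noncomputable def edgeStep (α : S) (i : ℕ) (x : V × ℕ) : Option (V × ℕ) :=
  if h : x.1 = E.source α ∧ ∃ k, B.loc α k = (x.2, i) then some (E.range α, h.2.choose) else none

open Classical in
/-- The partial map by which `α_{i+1}^*` acts. -/
noncomputable def ghostStep (α : S) (i : ℕ) (x : V × ℕ) : Option (V × ℕ) :=
  if x.1 = E.range α ∧ (B.loc α x.2).2 = i then some (E.source α, (B.loc α x.2).1) else none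

/-- The partial map by which a generator acts. -/
noncomputable def step : E.Generator → V × ℕ → Option (V × ℕ)
  | .vertex v => idStep v Set.univ
  | .edge α i => B.edgeStep α i
  | .ghost α i => B.ghostStep α i

theorem edgeStep_of_loc {α : S} {n i k : ℕ} (h : B.loc α k = (n, i)) :
    B.edgeStep α i (E.source α, n) = some (E.range α, k) := by
  have h' : ∃ k, B.loc α k = (n, i) := ⟨k, h⟩
  have : h'.choose = k := (B.loc_inj α α _ _ rfl (h'.choose_spec.trans h.symm)).2
  simp [edgeStep, h', this]

theorem edgeStep_eq_none {α : S} {i : ℕ} {x : V × ℕ}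
    (h : ¬ (x.1 = E.source α ∧ ∃ k, B.loc α k = (x.2, i))) : B.edgeStep α i x = none := by
  simp only [edgeStep, dif_neg h]

theorem edgeStep_of_weight_le {α : S} {i : ℕ} (h : E.weight α ≤ i) (x : V × ℕ) :
    B.edgeStep α i x = none := by
  refine B.edgeStep_eq_none ?_
  rintro ⟨-, k, hk⟩
  have := B.loc_lt α k
  rw [hk] at this
  exact absurd this (not_lt.2 h)

theorem ghostStep_of_weight_le {α : S} {i : ℕ} (h : E.weight α ≤ i) (x : V × ℕ) :
    B.ghostStep α i x = none := by
  refine if_neg ?_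
  rintro ⟨-, hk⟩
  exact absurd (B.loc_lt α x.2) (not_lt.2 (hk ▸ h))

variable (R : Type*) [Ring R]

/-- The representation of the free `R`-ring on the functions `V × ℕ → R`. -/
noncomputable def freeRep : E.FreeRing R →ₙ+* Module.End ℤ (V × ℕ → R) where
  toFun := MonoidAlgebra.liftNC (Module.toModuleEnd ℤ (S := R) (V × ℕ → R) : R →+ _)
    (FreeSemigroup.lift fun g => pullback R (B.step g))
  map_mul' x y := by
    refine MonoidAlgebra.liftNC_mul _ _ _ _ ?_
    intro w u _
    clear * -
    induction u using FreeSemigroup.recOnMul with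
    | ih1 g => exact commute_pullback _ _
    | ih2 g u hg hu => rw [map_mul]; exact Commute.mul_right hg hu
  map_zero' := map_zero _
  map_add' := map_add _

variable {R}

theorem freeRep_single (w : FreeSemigroup E.Generator) (a : R) :
    B.freeRep R (MonoidAlgebra.single w a) = Module.toModuleEnd ℤ (S := R) (V × ℕ → R) a *
      FreeSemigroup.lift (fun g => pullback R (B.step g)) w :=
  MonoidAlgebra.liftNC_single _ _ _ _

theorem freeRep_smul (a : R) (x : E.FreeRing R) :
    B.freeRep R (a • x) = Module.toModuleEnd ℤ (S := R) (V × ℕ → R) a * B.freeRep R x := by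
  induction x using MonoidAlgebra.induction_linear with
  | zero => simp
  | add x y hx hy => rw [smul_add, map_add, hx, hy, map_add, mul_add]
  | single w b =>
    rw [MonoidAlgebra.smul_single, freeRep_single, freeRep_single, smul_eq_mul, map_mul, mul_assoc]

/-- Words commute with scalar operators, so a coefficient multiplied by `a` on the right amounts to
composing with `a` on the right. Together with `freeRep_smul` this makes the kernel a subbimodule.
-/
theorem freeRep_op_smul (a : R) (x : E.FreeRing R) :
    B.freeRep R (MulOpposite.op a • x) = B.freeRep R x * Module.toModuleEnd ℤ (S := R) (V × ℕ → R) a := by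
  induction x using MonoidAlgebra.induction_linear with
  | zero => simp
  | add x y hx hy => rw [smul_add, map_add, hx, hy, map_add, add_mul]
  | single w b =>
    rw [MonoidAlgebra.smul_single, freeRep_single, freeRep_single, MulOpposite.smul_eq_mul_unop,
      MulOpposite.unop_op, map_mul, mul_assoc, mul_assoc]
    congr 1
    induction w using FreeSemigroup.recOnMul with
    | ih1 g => exact commute_pullback _ _
    | ih2 g u hg hu =>
      rw [map_mul]
      exact Commute.mul_right hg hu

theorem freeRep_vertexElt (v : V) :
    B.freeRep R (E.vertexElt R v) = pullback R (idStep v Set.univ) := by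
  rw [vertexElt, freeRep_single, map_one, one_mul]; rfl

theorem freeRep_edgeElt (α : S) (i : ℕ) :
    B.freeRep R (E.edgeElt R α i) = pullback R (B.edgeStep α i) := by
  unfold edgeElt
  split_ifs with h
  · rw [freeRep_single, map_one, one_mul]; rfl
  · rw [map_zero]
    refine LinearMap.ext fun m => funext fun x => ?_
    rw [pullback_apply, B.edgeStep_of_weight_le (not_lt.1 h)]
    rfl

theorem freeRep_ghostElt (α : S) (i : ℕ) :
    B.freeRep R (E.ghostElt R α i) = pullback R (B.ghostStep α i) := by
  unfold ghostElt
  split_ifs with h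
  · rw [freeRep_single, map_one, one_mul]; rfl
  · rw [map_zero]
    refine LinearMap.ext fun m => funext fun x => ?_
    rw [pullback_apply, B.ghostStep_of_weight_le (not_lt.1 h)]
    rfl

/-- Pullback reverses composition: in a product the left factor moves the point first, so words are
read along paths from left to right. -/
theorem pullback_mul_pullback {t u w : V × ℕ → Option (V × ℕ)} (h : ∀ x, (t x).bind u = w x) :
    pullback R t * pullback R u = pullback R w := by
  refine LinearMap.ext fun m => funext fun x => ?_
  rw [Module.End.mul_apply, pullback_apply, pullback_apply, ← h]
  cases t x <;> rfl

theorem pullback_none {t : V × ℕ → Option (V × ℕ)} (h : ∀ x, t x = none) :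
    pullback R t = 0 := by
  refine LinearMap.ext fun m => funext fun x => ?_
  rw [pullback_apply, h]
  rfl

theorem idStep_bind_edgeStep (α : S) (i : ℕ) (x : V × ℕ) :
    (idStep (E.source α) Set.univ x).bind (B.edgeStep α i) = B.edgeStep α i x := by
  by_cases h : x.1 = E.source α
  · simp [idStep, h]
  · simp [idStep, h, edgeStep]

/-- Relation 3 holds since each pair `(n, i)` at a vertex equals `loc α k` for exactly one `α` and
`k`, so one summand survives, and the way back by `α_{j+1}^*` exists only for `j = i`. Relation 4
holds since `(r(α), k)` can go back only in row `(loc α k).2`, and the only edge leading on from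
that pair is `α` itself. -/
theorem freeRep_rel {x y : E.FreeRing R} (h : E.LeavittRel R x y) :
    B.freeRep R x = B.freeRep R y := by
  cases h with
  | vertex_mul_self v =>
    rw [map_mul, freeRep_vertexElt]
    refine pullback_mul_pullback fun x => ?_
    by_cases h : x.1 = v <;> simp [idStep, h]
  | vertex_mul_of_ne v w h =>
    rw [map_mul, freeRep_vertexElt, freeRep_vertexElt, map_zero,
      ← pullback_none (t := fun _ => none) fun _ => rfl]
    refine pullback_mul_pullback fun x => ?_
    by_cases h' : x.1 = v
    · subst h'; simp [idStep, h]
    · simp [idStep, h']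
  | source_mul_edge α i h =>
    rw [map_mul, freeRep_vertexElt, freeRep_edgeElt]
    exact pullback_mul_pullback fun x => B.idStep_bind_edgeStep α i x
  | edge_mul_range α i h =>
    rw [map_mul, freeRep_vertexElt, freeRep_edgeElt]
    refine pullback_mul_pullback fun x => ?_
    by_cases h : x.1 = E.source α ∧ ∃ k, B.loc α k = (x.2, i) <;> simp [idStep, edgeStep, h]
  | range_mul_ghost α i h =>
    rw [map_mul, freeRep_vertexElt, freeRep_ghostElt]
    refine pullback_mul_pullback fun x => ?_
    by_cases h : x.1 = E.range α <;> simp [idStep, ghostStep, h]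
  | ghost_mul_source α i h =>
    rw [map_mul, freeRep_vertexElt, freeRep_ghostElt]
    refine pullback_mul_pullback fun x => ?_
    by_cases h : x.1 = E.range α ∧ (B.loc α x.2).2 = i <;> simp [idStep, ghostStep, h]
  | sum_edge_ghost v hv i j hi hj =>
    rw [map_sum]
    refine LinearMap.ext fun m => funext fun x => ?_
    simp only [map_mul, freeRep_edgeElt, freeRep_ghostElt]
    rw [LinearMap.sum_apply, Finset.sum_apply]
    obtain ⟨w, n⟩ := x
    simp only [Module.End.mul_apply, pullback_apply]
    by_cases hw : w = v
    · subst hw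
      obtain ⟨γ, hγ, hγi⟩ := hi
      obtain ⟨α, k, hα, hk⟩ := B.loc_surj γ n i hγi
      have hα' := hα.trans hγ
      rw [Finset.sum_eq_single α]
      · subst hα'
        rw [B.edgeStep_of_loc hk]
        by_cases hij : i = j
        · simp [hij, freeRep_vertexElt, pullback_apply, ghostStep, hk, idStep]
        · simp [hij, pullback_apply, ghostStep, hk]
      · intro β hβ hβα
        have hβ' : E.source β = w := by simpa using hβ
        rw [B.edgeStep_eq_none]
        · rfl
        · rintro ⟨-, l, hl⟩
          exact hβα (B.loc_inj β α l k (hβ'.trans hα'.symm) (hl.trans hk.symm)).1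
      · intro h
        exact absurd (by simpa using hα') h
    · have h0 : B.freeRep R (if i = j then E.vertexElt R v else 0) m (w, n) = 0 := by
        by_cases hij : i = j
        · simp [hij, freeRep_vertexElt, pullback_apply, idStep, hw]
        · simp [hij]
      rw [h0]
      refine Finset.sum_eq_zero fun β hβ => ?_
      have hβ' : E.source β = v := by simpa using hβ
      rw [B.edgeStep_eq_none]
      · rfl
      · rintro ⟨h, -⟩
        exact hw (h.trans hβ')
  | sum_ghost_edge_self α =>
    rw [map_sum]
    refine LinearMap.ext fun m => funext fun x => ?_
    simp only [map_mul, freeRep_edgeElt, freeRep_ghostElt, freeRep_vertexElt]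
    rw [LinearMap.sum_apply, Finset.sum_apply]
    obtain ⟨w, k⟩ := x
    simp only [Module.End.mul_apply, pullback_apply]
    by_cases hw : w = E.range α
    · subst hw
      rw [Finset.sum_eq_single (B.loc α k).2]
      · simp [ghostStep, pullback_apply, idStep, B.edgeStep_of_loc (α := α) (k := k) rfl]
      · intro i _ hi
        simp [ghostStep, hi.symm]
      · intro h
        exact absurd (Finset.mem_range.2 (B.loc_lt α k)) h
    · simp [ghostStep, idStep, hw]
  | sum_ghost_edge_of_ne α β hne =>
    rw [map_sum, map_zero]
    refine Finset.sum_eq_zero fun i _ => ?_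
    rw [map_mul, freeRep_edgeElt, freeRep_ghostElt,
      ← pullback_none (t := fun _ => none) fun _ => rfl]
    refine pullback_mul_pullback fun x => ?_
    by_cases h : x.1 = E.range α ∧ (B.loc α x.2).2 = i
    · rw [ghostStep, if_pos h, Option.bind_some]
      refine B.edgeStep_eq_none ?_
      rintro ⟨hs, l, hl⟩
      refine hne (B.loc_inj α β x.2 l hs ?_).1
      rw [hl, ← h.2]
    · rw [ghostStep, if_neg h, Option.bind_none]

variable (R) in
/-- The representation of the weighted Leavitt path algebra defined by a branching system. -/
noncomputable def rep : WeightedLeavittPathAlgebra R E →ₙ+* Module.End ℤ (V × ℕ → R) :=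
  WeightedLeavittPathAlgebra.lift (B.freeRep R)
    (by
      intro a x hx
      rw [freeRep_smul, freeRep_op_smul, hx, mul_zero, zero_mul]
      exact ⟨rfl, rfl⟩)
    (fun _ _ => B.freeRep_rel)

theorem rep_mk (x : E.FreeRing R) :
    B.rep R (WeightedLeavittPathAlgebra.mk R E x) = B.freeRep R x := rfl

/-- `B.Cuts z v Z` says that `z` acts as the projection onto the subset `Z` of the copy of `ℕ` at
`v`. -/
def Cuts (z : WeightedLeavittPathAlgebra R E) (v : V) (Z : Set ℕ) : Prop :=
  B.rep R z = pullback R (idStep v Z)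

variable {B}

theorem cuts_vertex (v : V) :
    B.Cuts (WeightedLeavittPathAlgebra.mk R E (E.vertexElt R v)) v Set.univ :=
  B.freeRep_vertexElt v

theorem Cuts.mul {z z' : WeightedLeavittPathAlgebra R E} {v : V} {Z Z' : Set ℕ}
    (h : B.Cuts z v Z) (h' : B.Cuts z' v Z') : B.Cuts (z * z') v (Z ∩ Z') := by
  rw [Cuts, map_mul, h, h']
  refine pullback_mul_pullback fun x => ?_
  by_cases h1 : x.1 = v <;> by_cases h2 : x.2 ∈ Z <;> by_cases h3 : x.2 ∈ Z' <;>
    simp [idStep, h1, h2, h3]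

/-- A point `k` at `r(α)` is carried back to `loc α k`, tested for row `0` and for membership in
`Z`, and then returned to `k`. -/
theorem Cuts.pushforward {z : WeightedLeavittPathAlgebra R E} {α : S} {Z : Set ℕ}
    (h : B.Cuts z (E.source α) Z) :
    B.Cuts (WeightedLeavittPathAlgebra.mk R E (E.ghostElt R α 0) * z *
      WeightedLeavittPathAlgebra.mk R E (E.edgeElt R α 0)) (E.range α)
      {k | (B.loc α k).1 ∈ Z ∧ (B.loc α k).2 = 0} := by
  rw [Cuts, map_mul, map_mul, h, rep_mk, rep_mk, freeRep_edgeElt, freeRep_ghostElt,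
    pullback_mul_pullback (fun _ => rfl)]
  refine pullback_mul_pullback fun ⟨w, k⟩ => ?_
  by_cases hw : w = E.range α
  · subst hw
    by_cases h0 : (B.loc α k).2 = 0
    · by_cases hZ : (B.loc α k).1 ∈ Z
      · have := B.edgeStep_of_loc (α := α) (k := k) (n := (B.loc α k).1) (i := 0)
          (Prod.ext rfl h0)
        simp [ghostStep, idStep, h0, hZ, this]
      · simp [ghostStep, idStep, h0, hZ]
    · simp [ghostStep, idStep, h0]
  · simp [ghostStep, idStep, hw]

theorem cuts_edge_mul_ghost (α : S) :
    B.Cuts (WeightedLeavittPathAlgebra.mk R E (E.edgeElt R α 0) *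
      WeightedLeavittPathAlgebra.mk R E (E.ghostElt R α 0)) (E.source α)
      {n | ∃ k, B.loc α k = (n, 0)} := by
  rw [Cuts, map_mul, rep_mk, rep_mk, freeRep_edgeElt, freeRep_ghostElt]
  refine pullback_mul_pullback fun ⟨w, n⟩ => ?_
  by_cases hw : w = E.source α
  · subst hw
    by_cases h0 : ∃ k, B.loc α k = (n, 0)
    · obtain ⟨k, hk⟩ := h0
      rw [B.edgeStep_of_loc hk]
      have : ∃ k, B.loc α k = (n, 0) := ⟨k, hk⟩
      simp [ghostStep, idStep, hk, this]
    · rw [B.edgeStep_eq_none (by simpa using h0)]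
      simp [idStep, h0]
  · rw [B.edgeStep_eq_none (by simp [hw])]
    simp [idStep, hw]

theorem Cuts.rep_eq_zero {z : WeightedLeavittPathAlgebra R E} {v : V} {Z : Set ℕ}
    (h : B.Cuts z v Z) (hZ : Z = ∅) : B.rep R z = 0 := by
  rw [h]
  exact pullback_none fun x => by simp [idStep, hZ]

theorem Cuts.rep_ne_zero [Nontrivial R] {z : WeightedLeavittPathAlgebra R E} {v : V} {Z : Set ℕ}
    (h : B.Cuts z v Z) (hZ : Z.Nonempty) : B.rep R z ≠ 0 := by
  obtain ⟨n, hn⟩ := hZ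
  intro h0
  have h1 : B.rep R z (fun _ => 1) (v, n) = 0 := by rw [h0]; rfl
  rw [h] at h1
  simp [pullback_apply, idStep, hn] at h1

end WeightedGraph.BranchingSystem

/-! ### Simplicity as a constraint on branching systems -/

namespace WeightedLeavittPathAlgebra

open WeightedGraph

variable {V S : Type*} {R : Type*} [Ring R] {E : WeightedGraph V S}

theorem nontrivial_of_isSimpleRing (h : IsSimpleRing (WeightedLeavittPathAlgebra R E)) :
    Nontrivial R := by
  by_contra hR
  rw [not_nontrivial_iff_subsingleton] at hR
  have h0 : ∀ x : WeightedLeavittPathAlgebra R E, x = 0 := fun x => by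
    rw [← one_smul R x, Subsingleton.elim (1 : R) 0, zero_smul]
  refine h.simple.bot_ne_top (le_antisymm bot_le fun x _ => ?_)
  rw [h0 x]
  exact TwoSidedIdeal.zero_mem _

/-- If the weighted Leavitt path algebra is simple, then an element cannot act as the empty
projection with respect to one branching system and as a nonempty projection with respect to
another. -/
theorem not_cuts_of_isSimpleRing (h : IsSimpleRing (WeightedLeavittPathAlgebra R E))
    {B B' : BranchingSystem E} {z : WeightedLeavittPathAlgebra R E} {v v' : V} {Z Z' : Set ℕ}
    (hz : B.Cuts z v Z) (hZ : Z = ∅) (hz' : B'.Cuts z v' Z') : ¬ Z'.Nonempty := by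
  intro hZ'
  have := nontrivial_of_isSimpleRing h
  have hmem : z ∈ TwoSidedIdeal.ker (B.rep R) := by
    rw [TwoSidedIdeal.mem_ker]
    exact hz.rep_eq_zero hZ
  -- The kernel of the first representation contains `z`. It is not zero, as `z` acts nontrivially
  -- in the second one, and not everything, as the vertex `v` acts nontrivially in the first.
  rcases h.simple.eq_bot_or_eq_top (TwoSidedIdeal.ker (B.rep R)) with h1 | h1
  · rw [h1, TwoSidedIdeal.mem_bot] at hmem
    exact hz'.rep_ne_zero hZ' (by rw [hmem, map_zero])
  · have h2 : mk R E (E.vertexElt R v) ∈ TwoSidedIdeal.ker (B.rep R) := by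
      rw [h1]
      trivial
    rw [TwoSidedIdeal.mem_ker] at h2
    exact (BranchingSystem.cuts_vertex (B := B) v).rep_ne_zero Set.univ_nonempty h2

end WeightedLeavittPathAlgebra

/-! ### Constructing branching systems -/

section Infinite

/-- Identify `Z` with `ℕ × ℕ` and colour by the first coordinate through a surjection `ℕ → A`; each
fibre contains a whole column. -/
theorem exists_infinite_fibers {A : Type*} [Countable A] [Nonempty A] {Z : Set ℕ}
    (hZ : Z.Infinite) : ∃ h : ℕ → A, ∀ a, {n | n ∈ Z ∧ h n = a}.Infinite := by
  classical
  have := hZ.to_subtype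
  obtain ⟨e⟩ := nonempty_equiv_of_countable (α := Z) (β := ℕ × ℕ)
  obtain ⟨g, hg⟩ := exists_surjective_nat A
  refine ⟨fun n => if hn : n ∈ Z then g (e ⟨n, hn⟩).1 else Classical.arbitrary A, fun a => ?_⟩
  obtain ⟨l, rfl⟩ := hg a
  refine Set.infinite_of_injective_forall_mem (f := fun k : ℕ => (e.symm (l, k) : ℕ)) ?_ ?_
  · intro k k' hk
    simpa using e.symm.injective (Subtype.ext hk)
  · intro k
    simp

theorem exists_equiv_mem_iff {Z Z' : Set ℕ} (h : Z.Infinite) (hc : Zᶜ.Infinite)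
    (h' : Z'.Infinite) (hc' : Z'ᶜ.Infinite) : ∃ σ : ℕ ≃ ℕ, ∀ k, σ k ∈ Z' ↔ k ∈ Z := by
  classical
  have := h.to_subtype
  have := hc.to_subtype
  have := h'.to_subtype
  have := hc'.to_subtype
  obtain ⟨e⟩ := nonempty_equiv_of_countable (α := Z) (β := Z')
  obtain ⟨e'⟩ := nonempty_equiv_of_countable (α := (Zᶜ : Set ℕ)) (β := (Z'ᶜ : Set ℕ))
  refine ⟨(Equiv.Set.sumCompl Z).symm.trans ((Equiv.sumCongr e e').trans (Equiv.Set.sumCompl Z')),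
    fun k => ?_⟩
  by_cases hk : k ∈ Z
  · simp [Equiv.Set.sumCompl_symm_apply_of_mem hk, hk]
  · have := (e' ⟨k, hk⟩).2
    rw [Set.mem_compl_iff] at this
    simp [Equiv.Set.sumCompl_symm_apply_of_notMem hk, hk, this]

end Infinite

namespace WeightedGraph

variable {V S : Type*} {E : WeightedGraph V S}

/-- The part at a vertex `v` of a branching system. -/
structure IsLocalSystem (E : WeightedGraph V S) (v : V) (loc : S → ℕ → ℕ × ℕ) : Prop where
  lt : ∀ α k, E.source α = v → (loc α k).2 < E.weight α
  inj : ∀ α β k l, E.source α = v → E.source β = v → loc α k = loc β l → α = β ∧ k = l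
  surj : ∀ α n i, E.source α = v → i < E.weight α → ∃ β k, E.source β = v ∧ loc β k = (n, i)

/-- A local system from a colouring of the pairs `(n, i)` by the structured edges. -/
theorem exists_isLocalSystem_of_colouring (v : V) (c : ℕ → ℕ → S)
    (hc : ∀ n i γ, E.source γ = v → i < E.weight γ →
      E.source (c n i) = v ∧ i < E.weight (c n i))
    (hinf : ∀ α, E.source α = v → {p : ℕ × ℕ | p.2 < E.weight α ∧ c p.1 p.2 = α}.Infinite) :
    ∃ loc, E.IsLocalSystem v loc ∧ ∀ α, E.source α = v → ∀ n i,
      (∃ k, loc α k = (n, i)) ↔ i < E.weight α ∧ c n i = α := by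
  classical
  have he : ∀ α, E.source α = v →
      Nonempty (ℕ ≃ {p : ℕ × ℕ | p.2 < E.weight α ∧ c p.1 p.2 = α}) := fun α hα => by
    have := (hinf α hα).to_subtype
    exact nonempty_equiv_of_countable
  -- The colour of a pair names the edge it belongs to. Each colour class is countably infinite, so
  -- an enumeration of it can serve as `loc α`.
  let e := fun α hα => Classical.choice (he α hα)
  obtain ⟨loc, hloc⟩ : ∃ loc : S → ℕ → ℕ × ℕ, ∀ α (h : E.source α = v) k, loc α k = e α h k :=
    ⟨fun α k => if h : E.source α = v then e α h k else (0, 0), fun α h k => by simp [h]⟩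
  have hiff : ∀ α, E.source α = v → ∀ n i,
      (∃ k, loc α k = (n, i)) ↔ i < E.weight α ∧ c n i = α := by
    intro α hα n i
    constructor
    · rintro ⟨k, hk⟩
      have := (e α hα k).2
      rw [← hloc α hα, hk] at this
      exact this
    · intro h
      refine ⟨(e α hα).symm ⟨(n, i), h⟩, ?_⟩
      rw [hloc α hα, Equiv.apply_symm_apply]
  refine ⟨loc, ⟨?_, ?_, ?_⟩, hiff⟩
  · intro α k hα
    exact ((hiff α hα _ _).1 ⟨k, rfl⟩).1
  · intro α β k l hα hβ h
    have h1 : c (loc α k).1 (loc α k).2 = α := ((hiff α hα _ _).1 ⟨k, rfl⟩).2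
    have h2 : c (loc β l).1 (loc β l).2 = β := ((hiff β hβ _ _).1 ⟨l, rfl⟩).2
    rw [h] at h1
    obtain rfl : α = β := h1.symm.trans h2
    clear h1 h2
    refine ⟨rfl, ?_⟩
    rw [hloc α hα, hloc α hα] at h
    exact (e α hα).injective (Subtype.ext h)
  · intro α n i hα hi
    obtain ⟨h1, h2⟩ := hc n i α hα hi
    obtain ⟨k, hk⟩ := (hiff _ h1 n i).2 ⟨h2, rfl⟩
    exact ⟨c n i, k, h1, hk⟩

/-- There is a local system at `v` such that the pairs `(n, 0)` with `n ∈ Z` belong precisely to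
the edges in `A`, provided that there is room for the other edge `α`, if there is one, elsewhere. -/
theorem exists_isLocalSystem [Countable S] {v : V} {Z : Set ℕ} (hZ : Z.Infinite) {A : Set S}
    (hA : A.Nonempty) (hAv : ∀ γ ∈ A, E.source γ = v) {α : S} (hα : E.source α = v)
    (hcov : ∀ γ, E.source γ = v → γ ∈ A ∨ (γ = α ∧ (Zᶜ.Infinite ∨ 1 < E.weight α))) :
    ∃ loc, E.IsLocalSystem v loc ∧ ∀ γ, E.source γ = v →
      ((∃ n ∈ Z, ∃ k, loc γ k = (n, 0)) ↔ γ ∈ A) := by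
  classical
  have := hA.to_subtype
  obtain ⟨h, hh⟩ := exists_infinite_fibers (A := A) hZ
  -- Row `0` over `Z` is shared among `A` with infinite fibres. The rest of row `0`, and row `1` if
  -- `α` has weight greater than `1`, go to `α`, which secures an infinite class for `α` even if it
  -- is not in `A`. Any other pair goes to some edge of sufficient weight; the last value is reached
  -- only for pairs that no edge at `v` admits.
  let c : ℕ → ℕ → S := fun n i =>
    if i = 0 then if n ∈ Z then h n else α
    else if i = 1 ∧ 1 < E.weight α then α
    else if hi : ∃ γ, E.source γ = v ∧ i < E.weight γ then hi.choose else α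
  have hc0 : ∀ n ∈ Z, c n 0 = h n := fun n hn => by simp [c, hn]
  obtain ⟨loc, hloc, hiff⟩ := exists_isLocalSystem_of_colouring (E := E) v c
    (by
      intro n i γ hγ hi
      have hi' : ∃ γ, E.source γ = v ∧ i < E.weight γ := ⟨γ, hγ, hi⟩
      by_cases h0 : i = 0
      · subst h0
        refine ⟨?_, E.weight_pos _⟩
        by_cases hn : n ∈ Z
        · simpa [c, hn] using hAv _ (h n).2
        · simpa [c, hn] using hα
      by_cases h1 : i = 1 ∧ 1 < E.weight α
      · obtain ⟨rfl, h1⟩ := h1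
        simp [c, h1, hα]
      · simpa only [c, if_neg h0, if_neg h1, dif_pos hi'] using hi'.choose_spec)
    (by
      intro γ hγ
      rcases hcov γ hγ with hγA | ⟨rfl, hZc | hw⟩
      · refine Set.infinite_of_injOn_mapsTo (f := fun n : ℕ => (n, 0)) ?_ ?_ (hh ⟨γ, hγA⟩)
        · intro n _ m _ hnm
          simpa using hnm
        · rintro n ⟨hn, hn'⟩
          exact ⟨E.weight_pos _, by simp [hc0 n hn, hn']⟩
      · refine Set.infinite_of_injOn_mapsTo (f := fun n : ℕ => (n, 0)) ?_ ?_ hZc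
        · intro n _ m _ hnm
          simpa using hnm
        · intro n hn
          exact ⟨E.weight_pos _, by simp [c, show n ∉ Z from hn]⟩
      · refine Set.infinite_of_injective_forall_mem (f := fun n : ℕ => (n, 1)) ?_ ?_
        · intro n m hnm
          simpa using hnm
        · intro n
          exact ⟨hw, by simp [c, hw]⟩)
  refine ⟨loc, hloc, fun γ hγ => ?_⟩
  constructor
  · rintro ⟨n, hn, hk⟩
    have := ((hiff γ hγ n 0).1 hk).2
    rw [hc0 n hn] at this
    exact this ▸ (h n).2
  · intro hγA
    obtain ⟨n, hn, hn'⟩ := (hh ⟨γ, hγA⟩).nonempty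
    exact ⟨n, hn, (hiff γ hγ n 0).2 ⟨E.weight_pos _, by simp [hc0 n hn, hn']⟩⟩

theorem nonempty_branchingSystem [Countable S] (E : WeightedGraph V S) :
    Nonempty (BranchingSystem E) := by
  have h : ∀ v, ∃ loc, E.IsLocalSystem v loc := by
    intro v
    by_cases hv : ∃ α, E.source α = v
    · obtain ⟨α, hα⟩ := hv
      obtain ⟨loc, hloc, -⟩ := exists_isLocalSystem (E := E) Set.infinite_univ
        (A := {γ | E.source γ = v}) ⟨α, hα⟩ (fun _ h => h) hα fun _ h => Or.inl h
      exact ⟨loc, hloc⟩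
    · exact ⟨fun _ _ => (0, 0), fun α _ h => absurd ⟨α, h⟩ hv, fun α _ _ _ h => absurd ⟨α, h⟩ hv,
        fun α _ _ h => absurd ⟨α, h⟩ hv⟩
  choose loc hloc using h
  exact ⟨fun α => loc (E.source α) α, fun α k => (hloc _).lt α k rfl,
    fun α β k l h h' => (hloc (E.source α)).inj α β k l rfl h.symm (by simpa only [h] using h'),
    fun α n i hi => by
      obtain ⟨β, k, h, h'⟩ := (hloc (E.source α)).surj α n i rfl hi
      exact ⟨β, k, h, by simpa only [h] using h'⟩⟩

/-- Two branching systems agree outside the vertex `c`. -/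
def BranchingSystem.AgreeOff (c : V) (B B' : BranchingSystem E) : Prop :=
  ∀ α, E.source α ≠ c → B'.loc α = B.loc α

theorem BranchingSystem.isLocalSystem (B : BranchingSystem E) (v : V) :
    E.IsLocalSystem v B.loc :=
  ⟨fun α k _ => B.loc_lt α k, fun α β k l h h' => B.loc_inj α β k l (h.trans h'.symm),
    fun α n i h hi => by
      obtain ⟨β, k, h', hk⟩ := B.loc_surj α n i hi
      exact ⟨β, k, h'.trans h, hk⟩⟩

/-- A branching system may be replaced at a single vertex. -/
theorem BranchingSystem.exists_agreeOff (B : BranchingSystem E) {c : V} {loc : S → ℕ → ℕ × ℕ}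
    (h : E.IsLocalSystem c loc) :
    ∃ B' : BranchingSystem E, B.AgreeOff c B' ∧ ∀ α, E.source α = c → B'.loc α = loc α := by
  classical
  have key : ∀ v, E.IsLocalSystem v (fun α => if E.source α = c then loc α else B.loc α) := by
    intro v
    by_cases hv : v = c
    · subst hv
      refine ⟨fun α k hα => ?_, fun α β k l hα hβ => ?_, fun α n i hα hi => ?_⟩
      · simpa [hα] using h.lt α k hα
      · simpa [hα, hβ] using h.inj α β k l hα hβ
      · obtain ⟨β, k, hβ, hk⟩ := h.surj α n i hα hi
        exact ⟨β, k, hβ, by simpa [hβ] using hk⟩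
    · have h' := B.isLocalSystem v
      refine ⟨fun α k hα => ?_, fun α β k l hα hβ => ?_, fun α n i hα hi => ?_⟩
      · simpa [hα, hv] using h'.lt α k hα
      · simpa [hα, hβ, hv] using h'.inj α β k l hα hβ
      · obtain ⟨β, k, hβ, hk⟩ := h'.surj α n i hα hi
        exact ⟨β, k, hβ, by simpa [hβ, hv] using hk⟩
  exact ⟨⟨_, fun α k => (key _).lt α k rfl, fun α β k l h => (key _).inj α β k l rfl h.symm,
    fun α n i => (key _).surj α n i rfl⟩, fun α hα => if_neg hα, fun α hα => if_pos hα⟩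

end WeightedGraph

/-! ### Transporting projections along paths -/

namespace WeightedGraph

variable {V S : Type*} {E : WeightedGraph V S}

/-- `x` emits exactly one structured edge, which ends in `y`, and `x ≠ c`. -/
def SingleStep (E : WeightedGraph V S) (c x y : V) : Prop :=
  ∃ p, E.source p = x ∧ E.range p = y ∧ (∀ q, E.source q = E.source p → q = p) ∧ E.source p ≠ c

/-- In all branching systems which agree with `B` outside `c`, the element `z` acts as the
projection onto the subset `Z` of the copy of `ℕ` at `v`. -/
def BranchingSystem.CutsOff {R : Type*} [Ring R] (B : BranchingSystem E) (c : V)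
    (z : WeightedLeavittPathAlgebra R E) (v : V) (Z : Set ℕ) : Prop :=
  ∀ B', B.AgreeOff c B' → B'.Cuts z v Z

theorem BranchingSystem.infinite_preimage_loc (B : BranchingSystem E) {p : S}
    (hp : ∀ q, E.source q = E.source p → q = p) {T : Set (ℕ × ℕ)} (hT : T.Infinite)
    (hT' : ∀ x ∈ T, x.2 < E.weight p) : {k | B.loc p k ∈ T}.Infinite := by
  refine Set.Infinite.of_image (B.loc p) (hT.mono ?_)
  rintro ⟨n, i⟩ hx
  obtain ⟨q, k, hq, hk⟩ := B.loc_surj p n i (hT' _ hx)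
  obtain rfl := hp q hq
  exact ⟨k, by rwa [Set.mem_ofPred_eq, hk], hk⟩

/-- As `p` is the only edge at its source, `loc p` reaches all admissible pairs. The pairs `(n, 0)`
with `n ∈ Z` give the first set. Its complement is fed by the pairs `(n, 0)` with `n ∉ Z` or, at a
weighted vertex, by the pairs `(n, 1)`. -/
theorem BranchingSystem.infinite_pushforward (B : BranchingSystem E) {p : S}
    (hp : ∀ q, E.source q = E.source p → q = p) {Z : Set ℕ} (hZ : Z.Infinite)
    (hZ' : Zᶜ.Infinite ∨ E.IsWeightedVertex (E.source p)) :
    {k | (B.loc p k).1 ∈ Z ∧ (B.loc p k).2 = 0}.Infinite ∧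
      {k | (B.loc p k).1 ∈ Z ∧ (B.loc p k).2 = 0}ᶜ.Infinite := by
  have hinj : ∀ i : ℕ, Function.Injective fun n : ℕ => (n, i) := fun i n m h => by simpa using h
  constructor
  · refine (B.infinite_preimage_loc hp (hZ.image (hinj 0).injOn) ?_).mono ?_
    · rintro _ ⟨n, -, rfl⟩
      exact E.weight_pos p
    · rintro k ⟨n, hn, hk⟩
      rw [Set.mem_ofPred_eq, ← hk]
      exact ⟨hn, rfl⟩
  · rcases hZ' with hZ' | ⟨q, hq, hw⟩
    · refine (B.infinite_preimage_loc hp (hZ'.image (hinj 0).injOn) ?_).mono ?_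
      · rintro _ ⟨n, -, rfl⟩
        exact E.weight_pos p
      · rintro k ⟨n, hn, hk⟩
        rw [Set.mem_compl_iff, Set.mem_ofPred_eq, ← hk]
        exact fun h => hn h.1
    · obtain rfl := hp q hq
      refine (B.infinite_preimage_loc hp (Set.infinite_range_of_injective (hinj 1)) ?_).mono ?_
      · rintro _ ⟨n, rfl⟩
        exact hw
      · rintro k ⟨n, hk⟩
        rw [Set.mem_compl_iff, Set.mem_ofPred_eq, ← hk]
        exact fun h => one_ne_zero h.2

variable {R : Type*} [Ring R]

theorem BranchingSystem.CutsOff.pushforward {B : BranchingSystem E} {c : V}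
    {z : WeightedLeavittPathAlgebra R E} {p : S} {Z : Set ℕ} (h : B.CutsOff c z (E.source p) Z)
    (hc : E.source p ≠ c) :
    B.CutsOff c (WeightedLeavittPathAlgebra.mk R E (E.ghostElt R p 0) * z *
      WeightedLeavittPathAlgebra.mk R E (E.edgeElt R p 0)) (E.range p)
      {k | (B.loc p k).1 ∈ Z ∧ (B.loc p k).2 = 0} := by
  intro B' hB'
  have := (h B' hB').pushforward
  rwa [hB' p hc] at this

/-- The start is the full copy of `ℕ` at `u`, where the alternative holds by weightedness; the first
step makes the set co-infinite, and later steps preserve this. No step starts at `c`, so the set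
does not depend on the local system at `c`, which stays free for later choices. -/
theorem BranchingSystem.exists_cutsOff (R : Type*) [Ring R] (B : BranchingSystem E) {c u v : V}
    (hu : E.IsWeightedVertex u) (h : Relation.ReflTransGen (E.SingleStep c) u v) :
    ∃ (z : WeightedLeavittPathAlgebra R E) (Z : Set ℕ), B.CutsOff c z v Z ∧ Z.Infinite ∧
      (Zᶜ.Infinite ∨ E.IsWeightedVertex v) := by
  induction h with
  | refl => exact ⟨_, Set.univ, fun _ _ => cuts_vertex u, Set.infinite_univ, Or.inr hu⟩
  | tail _ hstep ih =>
    obtain ⟨z, Z, hz, hZ, hZ'⟩ := ih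
    obtain ⟨p, rfl, rfl, hp, hc⟩ := hstep
    obtain ⟨h1, h2⟩ := B.infinite_pushforward hp hZ hZ'
    exact ⟨_, _, hz.pushforward hc, h1, Or.inl h2⟩

/-- The path is cut at its first branching vertex `v'`; the vertices before it do not branch, so
they differ from `v'`. -/
theorem exists_singleStep_to_branching {u v : V} (h : E.Reaches u v)
    (hv : ¬ {α | E.source α = v}.Subsingleton) :
    ∃ v', ¬ {α | E.source α = v'}.Subsingleton ∧
      Relation.ReflTransGen (E.SingleStep v') u v' := by
  induction h using Relation.ReflTransGen.head_induction_on with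
  | refl => exact ⟨v, hv, .refl⟩
  | @head u w hstep _ ih =>
    by_cases hu : {α | E.source α = u}.Subsingleton
    · obtain ⟨v', hv', h⟩ := ih
      obtain ⟨p, rfl, rfl⟩ := hstep
      exact ⟨v', hv', .head ⟨p, rfl, rfl, fun q hq => hu hq rfl, fun h => hv' (h ▸ hu)⟩ h⟩
    · exact ⟨u, hu, .refl⟩

theorem mem_weightForest_of_reaches {u v : V} (hu : u ∈ E.weightForest) (h : E.Reaches u v) :
    v ∈ E.weightForest := by
  obtain ⟨w, hw, hwu⟩ := hu
  exact ⟨w, hw, hwu.trans h⟩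

theorem range_mem_weightForest {α : S} (h : E.source α ∈ E.weightForest) :
    E.range α ∈ E.weightForest :=
  mem_weightForest_of_reaches h (.single ⟨α, rfl, rfl⟩)

/-! ### Simplicity implies reducibility -/

theorem source_subsingleton_of_isSimpleRing [Countable S]
    (h : IsSimpleRing (WeightedLeavittPathAlgebra R E)) {v : V} (hv : v ∈ E.weightForest) :
    {α | E.source α = v}.Subsingleton := by
  by_contra hns
  obtain ⟨u, hu, huv⟩ := hv
  obtain ⟨w, hw, huw⟩ := exists_singleStep_to_branching huv hns
  obtain ⟨B⟩ := nonempty_branchingSystem E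
  obtain ⟨z, Z, hz, hZ, hZ'⟩ := B.exists_cutsOff R hu huw
  -- The edge `α` will be deprived of row `0` over `Z`, so it needs room elsewhere: in row `0` off
  -- `Z`, or in row `1`. The edge `β` keeps the set of remaining edges nonempty.
  obtain ⟨α, β, hα, hβ, hne, hαZ⟩ : ∃ α β, E.source α = w ∧ E.source β = w ∧ β ≠ α ∧
      (Zᶜ.Infinite ∨ 1 < E.weight α) := by
    rw [Set.not_subsingleton_iff] at hw
    rcases hZ' with hZ' | ⟨α, hα, hαw⟩
    · obtain ⟨α, hα, β, hβ, hne⟩ := hw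
      exact ⟨α, β, hα, hβ, hne.symm, Or.inl hZ'⟩
    · obtain ⟨β, hβ, hne⟩ := hw.exists_ne α
      exact ⟨α, β, hα, hβ, hne, Or.inr hαw⟩
  obtain ⟨loc, hloc, hiff⟩ := exists_isLocalSystem (E := E) hZ (A := {γ | E.source γ = w})
    ⟨α, hα⟩ (fun _ h => h) hα fun _ h => Or.inl h
  obtain ⟨loc', hloc', hiff'⟩ := exists_isLocalSystem (E := E) hZ
    (A := {γ | E.source γ = w ∧ γ ≠ α}) ⟨β, hβ, hne⟩ (fun _ h => h.1) hα fun γ hγ => by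
      by_cases hγα : γ = α
      · exact Or.inr ⟨hγα, hαZ⟩
      · exact Or.inl ⟨hγ, hγα⟩
  obtain ⟨B₁, hB₁, hB₁'⟩ := B.exists_agreeOff hloc
  obtain ⟨B₂, hB₂, hB₂'⟩ := B.exists_agreeOff hloc'
  subst hα
  refine WeightedLeavittPathAlgebra.not_cuts_of_isSimpleRing h
    ((hz B₂ hB₂).mul (BranchingSystem.cuts_edge_mul_ghost α)) ?_
    ((hz B₁ hB₁).mul (BranchingSystem.cuts_edge_mul_ghost α)) ?_
  · rw [Set.eq_empty_iff_forall_notMem]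
    rintro n ⟨hn, hk⟩
    rw [Set.mem_ofPred_eq, hB₂' α rfl] at hk
    exact ((hiff' α rfl).1 ⟨n, hn, hk⟩).2 rfl
  · obtain ⟨n, hn, hk⟩ := (hiff α rfl).2 rfl
    refine ⟨n, hn, ?_⟩
    rwa [Set.mem_ofPred_eq, hB₁' α rfl]

/-- A path to `v` cannot pass through `c`, since `c` would then reach `v`. -/
theorem reflTransGen_singleStep_of_not_reaches
    (hs : ∀ v ∈ E.weightForest, {α | E.source α = v}.Subsingleton) {c u v : V}
    (hu : u ∈ E.weightForest) (h : E.Reaches u v) (hc : ¬ E.Reaches c v) :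
    Relation.ReflTransGen (E.SingleStep c) u v := by
  induction h using Relation.ReflTransGen.head_induction_on with
  | refl => exact .refl
  | head hstep hrest ih =>
    obtain ⟨p, rfl, rfl⟩ := hstep
    refine .head ⟨p, rfl, rfl, fun q hq => hs _ hu hq rfl, ?_⟩ (ih (range_mem_weightForest hu))
    rintro rfl
    exact hc (.head ⟨p, rfl, rfl⟩ hrest)

/-- Here the path is stopped at its first visit to `c`. -/
theorem reflTransGen_singleStep_self
    (hs : ∀ v ∈ E.weightForest, {α | E.source α = v}.Subsingleton) {c u : V}
    (hu : u ∈ E.weightForest) (h : E.Reaches u c) :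
    Relation.ReflTransGen (E.SingleStep c) u c := by
  induction h using Relation.ReflTransGen.head_induction_on with
  | refl => exact .refl
  | @head u w hstep hrest ih =>
    by_cases huc : u = c
    · rw [huc]
    · obtain ⟨p, rfl, rfl⟩ := hstep
      exact .head ⟨p, rfl, rfl, fun q hq => hs _ hu hq rfl, huc⟩ (ih (range_mem_weightForest hu))

/-- The copies of `ℕ` at the ranges of the edges emitted by a vertex may be permuted. -/
theorem BranchingSystem.exists_agreeOff_perm (B : BranchingSystem E) (α : S)
    (σ : ℕ ≃ ℕ) :
    ∃ B' : BranchingSystem E, B.AgreeOff (E.source α) B' ∧ ∀ k, B'.loc α k = B.loc α (σ k) := by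
  have h : E.IsLocalSystem (E.source α) fun γ k => B.loc γ (σ k) := by
    refine ⟨fun γ k _ => B.loc_lt γ _, fun γ δ k l hγ hδ hkl => ?_, fun γ n i hγ hi => ?_⟩
    · obtain ⟨h1, h2⟩ := B.loc_inj γ δ _ _ (hγ.trans hδ.symm) hkl
      exact ⟨h1, σ.injective h2⟩
    · obtain ⟨δ, k, hδ, hk⟩ := B.loc_surj γ n i hi
      exact ⟨δ, σ.symm k, hδ.trans hγ, by rwa [Equiv.apply_symm_apply]⟩
  obtain ⟨B', h1, h2⟩ := B.exists_agreeOff h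
  exact ⟨B', h1, fun k => by rw [h2 α rfl]⟩

/-- If `s(α)` does not reach `s(β)`, the subset `W` obtained at the common range through `β` is
insensitive to changes at `s(α)`, whereas the subset obtained through `α` can be permuted at will
there. The product of the two projections can thus be made empty or nonempty. -/
theorem reaches_of_isSimpleRing [Countable S] (h : IsSimpleRing (WeightedLeavittPathAlgebra R E))
    {α β : S} (hα : E.source α ∈ E.weightForest) (hβ : E.source β ∈ E.weightForest)
    (hr : E.range β = E.range α) : E.Reaches (E.source α) (E.source β) := by
  by_contra hnr
  have hs := fun v => source_subsingleton_of_isSimpleRing h (v := v)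
  have hα1 : ∀ q, E.source q = E.source α → q = α := fun q hq => hs _ hα hq rfl
  have hβ1 : ∀ q, E.source q = E.source β → q = β := fun q hq => hs _ hβ hq rfl
  obtain ⟨B⟩ := nonempty_branchingSystem E
  obtain ⟨b, hb, hbβ⟩ := hβ
  obtain ⟨zβ, Zβ, hzβ, hZβ, hZβ'⟩ := B.exists_cutsOff R hb
    (reflTransGen_singleStep_of_not_reaches hs ⟨b, hb, .refl⟩ hbβ hnr)
  have hzv := hzβ.pushforward (fun hβα => hnr (hβα ▸ .refl))
  obtain ⟨hW, hW'⟩ := B.infinite_pushforward hβ1 hZβ hZβ'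
  rw [hr] at hzv
  set W := {k | (B.loc β k).1 ∈ Zβ ∧ (B.loc β k).2 = 0}
  obtain ⟨a, ha, haα⟩ := hα
  obtain ⟨zα, Zα, hzα, hZα, hZα'⟩ := B.exists_cutsOff R ha
    (reflTransGen_singleStep_self hs ⟨a, ha, .refl⟩ haα)
  obtain ⟨hY, hY'⟩ := B.infinite_pushforward hα1 hZα hZα'
  -- Composing `loc α` with `σ₁` turns the subset coming from `α` into `W`; composing it with `σ₂`
  -- turns it into the complement of `W`.
  obtain ⟨σ₁, hσ₁⟩ := exists_equiv_mem_iff hW hW' hY hY'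
  obtain ⟨σ₂, hσ₂⟩ := exists_equiv_mem_iff hW' (by rwa [compl_compl]) hY hY'
  obtain ⟨B₁, hB₁, hB₁'⟩ := B.exists_agreeOff_perm α σ₁
  obtain ⟨B₂, hB₂, hB₂'⟩ := B.exists_agreeOff_perm α σ₂
  refine WeightedLeavittPathAlgebra.not_cuts_of_isSimpleRing h
    ((hzv B₂ hB₂).mul (hzα B₂ hB₂).pushforward) ?_ ((hzv B₁ hB₁).mul (hzα B₁ hB₁).pushforward) ?_
  · rw [Set.eq_empty_iff_forall_notMem]
    rintro k ⟨hk, hk'⟩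
    rw [Set.mem_ofPred_eq, hB₂'] at hk'
    exact (hσ₂ k).1 hk' hk
  · obtain ⟨k, hk⟩ := hW.nonempty
    refine ⟨k, hk, ?_⟩
    rw [Set.mem_ofPred_eq, hB₁']
    exact (hσ₁ k).2 hk

/-- If all vertices of the weight forest emit at most one structured edge, then two edges in the
weight forest with the same range whose sources can be reached from each other are equal. -/
theorem eq_of_reaches_of_reaches
    (hs : ∀ v ∈ E.weightForest, {α | E.source α = v}.Subsingleton) {α β : S}
    (hα : E.source α ∈ E.weightForest) (hβ : E.source β ∈ E.weightForest)
    (hr : E.range α = E.range β) (hαβ : E.Reaches (E.source α) (E.source β))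
    (hβα : E.Reaches (E.source β) (E.source α)) : α = β := by
  classical
  -- The successor map on the weight forest, where the outgoing edge is unique; its value at a sink
  -- is a mere default.
  let f : V → V := fun x => if h : ∃ γ, E.source γ = x then E.range h.choose else x
  have hf : ∀ γ, E.source γ ∈ E.weightForest → f (E.source γ) = E.range γ := by
    intro γ hγ
    have h : ∃ δ, E.source δ = E.source γ := ⟨γ, rfl⟩
    simp only [f, dif_pos h]
    rw [hs _ hγ h.choose_spec rfl]
  have hiter : ∀ {u v}, u ∈ E.weightForest → E.Reaches u v → ∃ n, f^[n] u = v := by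
    intro u v hu huv
    induction huv with
    | refl => exact ⟨0, rfl⟩
    | tail hub hstep ih =>
      obtain ⟨n, hn⟩ := ih
      obtain ⟨γ, rfl, rfl⟩ := hstep
      exact ⟨n + 1, by
        rw [Function.iterate_succ_apply', hn, hf γ (mem_weightForest_of_reaches hu hub)]⟩
  by_contra hne
  have hne' : E.source α ≠ E.source β := fun h => hne (hs _ hβ h rfl)
  have hrange : ∀ {γ δ}, E.source γ ∈ E.weightForest → E.source γ ≠ E.source δ →
      E.Reaches (E.source γ) (E.source δ) → E.Reaches (E.range γ) (E.source δ) := by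
    intro γ δ hγ hγδ h
    rcases h.cases_head with h | ⟨w, ⟨ε, hε, rfl⟩, h⟩
    · exact absurd h hγδ
    · rwa [← hs _ hγ hε rfl]
  obtain ⟨n, hn⟩ := hiter (range_mem_weightForest hβ) (hrange hβ hne'.symm hβα)
  obtain ⟨m, hm⟩ := hiter (range_mem_weightForest hα) (hrange hα hne' hαβ)
  -- Both sources are periodic for `f`: one step leads to the common range, and `n` or `m` further
  -- steps lead back. They have the same image, and `f` is injective on periodic points.
  refine hne' ((Function.bijOn_periodicPts f).injOn ⟨n + 1, n.succ_pos, ?_⟩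
    ⟨m + 1, m.succ_pos, ?_⟩ ?_)
  · rw [Function.IsPeriodicPt, Function.IsFixedPt, Function.iterate_succ_apply, hf α hα, hr, hn]
  · rw [Function.IsPeriodicPt, Function.IsFixedPt, Function.iterate_succ_apply, hf β hβ, ← hr, hm]
  · rw [hf α hα, hf β hβ, hr]

theorem reducible_of_isSimpleRing [Countable S]
    (h : IsSimpleRing (WeightedLeavittPathAlgebra R E)) : E.Reducible := by
  have hs := fun v => source_subsingleton_of_isSimpleRing h (v := v)
  intro v hv
  refine ⟨hs v hv, ?_⟩
  rintro α ⟨rfl, hα⟩ β ⟨hβr, hβ⟩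
  exact eq_of_reaches_of_reaches hs hα hβ hβr.symm (reaches_of_isSimpleRing h hα hβ hβr)
    (reaches_of_isSimpleRing h hβ hα hβr.symm)

end WeightedGraph

/-! ### Generators, relations and the associated graph -/

namespace WeightedLeavittPathAlgebra

open WeightedGraph

section Generators

variable {V S : Type*} (R : Type*) [Ring R] (E : WeightedGraph V S)

/-- The image of the vertex `v` in the weighted Leavitt path algebra. -/
noncomputable def vertex (v : V) : WeightedLeavittPathAlgebra R E := mk R E (E.vertexElt R v)

/-- The image of `α_{i+1}` in the weighted Leavitt path algebra. -/
noncomputable def edge (α : S) (i : ℕ) : WeightedLeavittPathAlgebra R E := mk R E (E.edgeElt R α i)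

/-- The image of `α_{i+1}^*` in the weighted Leavitt path algebra. -/
noncomputable def ghost (α : S) (i : ℕ) : WeightedLeavittPathAlgebra R E :=
  mk R E (E.ghostElt R α i)

variable {R E}

theorem edge_eq_zero {α : S} {i : ℕ} (h : E.weight α ≤ i) : edge R E α i = 0 := by
  rw [edge, edgeElt, dif_neg (not_lt.2 h), mk_zero]

theorem ghost_eq_zero {α : S} {i : ℕ} (h : E.weight α ≤ i) : ghost R E α i = 0 := by
  rw [ghost, ghostElt, dif_neg (not_lt.2 h), mk_zero]

theorem vertex_mul_self (v : V) : vertex R E v * vertex R E v = vertex R E v :=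
  mk_eq_of_rel (.vertex_mul_self v)

theorem vertex_mul_vertex_of_ne {v w : V} (h : v ≠ w) : vertex R E v * vertex R E w = 0 :=
  mk_eq_of_rel (.vertex_mul_of_ne v w h)

theorem source_mul_edge (α : S) (i : ℕ) : vertex R E (E.source α) * edge R E α i = edge R E α i := by
  rcases lt_or_ge i (E.weight α) with h | h
  · exact mk_eq_of_rel (.source_mul_edge α i h)
  · rw [edge_eq_zero h, mul_zero]

theorem edge_mul_range (α : S) (i : ℕ) : edge R E α i * vertex R E (E.range α) = edge R E α i := by
  rcases lt_or_ge i (E.weight α) with h | h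
  · exact mk_eq_of_rel (.edge_mul_range α i h)
  · rw [edge_eq_zero h, zero_mul]

theorem range_mul_ghost (α : S) (i : ℕ) :
    vertex R E (E.range α) * ghost R E α i = ghost R E α i := by
  rcases lt_or_ge i (E.weight α) with h | h
  · exact mk_eq_of_rel (.range_mul_ghost α i h)
  · rw [ghost_eq_zero h, mul_zero]

theorem ghost_mul_source (α : S) (i : ℕ) :
    ghost R E α i * vertex R E (E.source α) = ghost R E α i := by
  rcases lt_or_ge i (E.weight α) with h | h
  · exact mk_eq_of_rel (.ghost_mul_source α i h)
  · rw [ghost_eq_zero h, zero_mul]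

theorem sum_edge_mul_ghost {v : V} (hv : {α | E.source α = v}.Finite) {i j : ℕ}
    (hi : ∃ α, E.source α = v ∧ i < E.weight α) (hj : ∃ α, E.source α = v ∧ j < E.weight α) :
    ∑ α ∈ hv.toFinset, edge R E α i * ghost R E α j = if i = j then vertex R E v else 0 := by
  have := mk_eq_of_rel (.sum_edge_ghost (R := R) v hv i j hi hj)
  rw [mk_sum] at this
  refine this.trans ?_
  split_ifs <;> rfl

theorem sum_ghost_mul_edge (α : S) :
    ∑ i ∈ Finset.range (E.weight α), ghost R E α i * edge R E α i = vertex R E (E.range α) := by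
  have := mk_eq_of_rel (.sum_ghost_edge_self (R := R) (E := E) α)
  rwa [mk_sum] at this

theorem sum_ghost_mul_edge_of_ne {α β : S} (h : α ≠ β) :
    ∑ i ∈ Finset.range (max (E.weight α) (E.weight β)), ghost R E α i * edge R E β i = 0 := by
  have := mk_eq_of_rel (.sum_ghost_edge_of_ne (R := R) (E := E) α β h)
  rwa [mk_sum] at this

theorem mul_eq_zero_of_vertex {x y : WeightedLeavittPathAlgebra R E} {v w : V} (h : v ≠ w)
    (hx : x * vertex R E v = x) (hy : vertex R E w * y = y) : x * y = 0 := by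
  rw [← hx, ← hy, mul_assoc, ← mul_assoc (vertex R E v), vertex_mul_vertex_of_ne h, zero_mul,
    mul_zero]

/-- Relation 3 has a single summand here. This is the form that orthogonality of the reversed edges
takes. -/
theorem edge_mul_ghost_of_unique {α : S} (hα : ∀ β, E.source β = E.source α → β = α) {i j : ℕ}
    (hi : i < E.weight α) (hj : j < E.weight α) :
    edge R E α i * ghost R E α j = if i = j then vertex R E (E.source α) else 0 := by
  have hset : {β | E.source β = E.source α} = {α} :=
    Set.eq_singleton_iff_unique_mem.2 ⟨rfl, hα⟩
  have hfin : {β | E.source β = E.source α}.Finite := hset ▸ Set.finite_singleton α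
  rw [← sum_edge_mul_ghost hfin ⟨α, rfl, hi⟩ ⟨α, rfl, hj⟩]
  have : hfin.toFinset = {α} := by ext β; simp [hset]
  rw [this, Finset.sum_singleton]

theorem ghost_mul_edge_self_of_weight {α : S} (hα : E.weight α = 1) :
    ghost R E α 0 * edge R E α 0 = vertex R E (E.range α) := by
  rw [← sum_ghost_mul_edge, hα, Finset.sum_range_one]

theorem ghost_mul_edge_of_ne_of_weight {α β : S} (h : α ≠ β) (hα : E.weight α = 1)
    (hβ : E.weight β = 1) : ghost R E α 0 * edge R E β 0 = 0 := by
  rw [← sum_ghost_mul_edge_of_ne h, hα, hβ, max_self, Finset.sum_range_one]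

end Generators

end WeightedLeavittPathAlgebra

namespace WeightedGraph

variable {V S : Type*} (E : WeightedGraph V S)

theorem weight_eq_one_of_source_notMem {E : WeightedGraph V S} {α : S}
    (h : E.source α ∉ E.weightForest) : E.weight α = 1 := by
  refine le_antisymm (not_lt.1 fun hw => h ⟨_, ⟨α, rfl, hw⟩, .refl⟩) (E.weight_pos α)

theorem coe_snd_eq_zero_of_source_notMem {E : WeightedGraph V S} {α : S}
    (h : E.source α ∉ E.weightForest) (k : Fin (E.weight α)) : (k : ℕ) = 0 :=
  Nat.lt_one_iff.1 (k.2.trans_eq (weight_eq_one_of_source_notMem h))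

/-- The graph associated with a weighted graph, as a weighted graph. -/
noncomputable abbrev assoc : WeightedGraph V E.Edge := E.associatedGraph.toWeightedGraph

variable {E}

theorem assoc_source_of_mem {e : E.Edge} (h : E.source e.1 ∈ E.weightForest) :
    E.assoc.source e = E.range e.1 := if_pos h

theorem assoc_source_of_notMem {e : E.Edge} (h : E.source e.1 ∉ E.weightForest) :
    E.assoc.source e = E.source e.1 := if_neg h

theorem assoc_range_of_mem {e : E.Edge} (h : E.source e.1 ∈ E.weightForest) :
    E.assoc.range e = E.source e.1 := if_pos h

theorem assoc_range_of_notMem {e : E.Edge} (h : E.source e.1 ∉ E.weightForest) :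
    E.assoc.range e = E.range e.1 := if_neg h

/-- The weight forest is closed under successors, so reversed edges start inside it. -/
theorem assoc_source_eq_iff_of_notMem {v : V} (hv : v ∉ E.weightForest) (e : E.Edge) :
    E.assoc.source e = v ↔ E.source e.1 = v := by
  by_cases h : E.source e.1 ∈ E.weightForest
  · rw [assoc_source_of_mem h]
    constructor
    · rintro rfl
      exact absurd (range_mem_weightForest h) hv
    · rintro rfl
      exact absurd h hv
  · rw [assoc_source_of_notMem h]

/-- Edges that are not reversed start outside the weight forest, so only reversed ones leave `v`. -/
theorem assoc_source_eq_iff_of_mem {v : V} (hv : v ∈ E.weightForest) (e : E.Edge) :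
    E.assoc.source e = v ↔ E.range e.1 = v ∧ E.source e.1 ∈ E.weightForest := by
  by_cases h : E.source e.1 ∈ E.weightForest
  · rw [assoc_source_of_mem h]
    simp [h]
  · rw [assoc_source_of_notMem h]
    simp only [h, and_false, iff_false]
    rintro rfl
    exact h hv

theorem Reducible.eq_of_source_eq (hr : E.Reducible) {α β : S} (hα : E.source α ∈ E.weightForest)
    (h : E.source β = E.source α) : β = α := (hr _ hα).1 h rfl

theorem Reducible.eq_of_range_eq (hr : E.Reducible) {α β : S} (hα : E.source α ∈ E.weightForest)
    (hβ : E.source β ∈ E.weightForest) (h : E.range β = E.range α) : β = α :=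
  (hr _ (range_mem_weightForest hα)).2 ⟨h, hβ⟩ ⟨rfl, hα⟩

/-- A forest vertex emits in `F` only the finitely many copies of at most one structured edge;
elsewhere row-finiteness of `E` applies. -/
theorem Reducible.rowFinite_assoc (hr : E.Reducible) (hE : E.RowFinite) : E.assoc.RowFinite := by
  intro v
  have key : ∀ T : Set S, T.Finite → {e : E.Edge | e.1 ∈ T}.Finite := by
    intro T hT
    have := hT.to_subtype
    refine (Set.finite_range fun x : Σ α : T, Fin (E.weight α) =>
      (⟨x.1, x.2⟩ : E.Edge)).subset ?_
    rintro ⟨α, i⟩ h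
    exact ⟨⟨⟨α, h⟩, i⟩, rfl⟩
  by_cases hv : v ∈ E.weightForest
  · refine (key _ (hr v hv).2.finite).subset fun e he => ?_
    exact (assoc_source_eq_iff_of_mem hv e).1 he
  · refine (key _ (hE v)).subset fun e he => ?_
    exact (assoc_source_eq_iff_of_notMem hv e).1 he

open Classical in
/-- The map on generators which exchanges `α_i` and `α_i^*` in the weight forest. -/
noncomputable def toAssocGenerator : E.Generator → E.assoc.Generator
  | .vertex v => .vertex v
  | .edge α i => if E.source α ∈ E.weightForest then .ghost ⟨α, i⟩ ⟨0, one_pos⟩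
      else .edge ⟨α, i⟩ ⟨0, one_pos⟩
  | .ghost α i => if E.source α ∈ E.weightForest then .edge ⟨α, i⟩ ⟨0, one_pos⟩
      else .ghost ⟨α, i⟩ ⟨0, one_pos⟩

open Classical in
/-- The inverse of `toAssocGenerator`. -/
noncomputable def ofAssocGenerator : E.assoc.Generator → E.Generator
  | .vertex v => .vertex v
  | .edge e _ => if E.source e.1 ∈ E.weightForest then .ghost e.1 e.2 else .edge e.1 e.2
  | .ghost e _ => if E.source e.1 ∈ E.weightForest then .edge e.1 e.2 else .ghost e.1 e.2

theorem ofAssocGenerator_toAssocGenerator (x : E.Generator) :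
    ofAssocGenerator (toAssocGenerator x) = x := by
  cases x with
  | vertex v => rfl
  | edge α i => by_cases h : E.source α ∈ E.weightForest <;>
      simp [toAssocGenerator, ofAssocGenerator, h]
  | ghost α i => by_cases h : E.source α ∈ E.weightForest <;>
      simp [toAssocGenerator, ofAssocGenerator, h]

theorem toAssocGenerator_ofAssocGenerator (x : E.assoc.Generator) :
    toAssocGenerator (ofAssocGenerator x) = x := by
  have h0 : ∀ i : Fin 1, i = ⟨0, one_pos⟩ := fun i => Subsingleton.elim _ _
  cases x with
  | vertex v => rfl
  | edge e i => obtain rfl := h0 i; by_cases h : E.source e.1 ∈ E.weightForest <;>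
      simp [toAssocGenerator, ofAssocGenerator, h] <;> rfl
  | ghost e i => obtain rfl := h0 i; by_cases h : E.source e.1 ∈ E.weightForest <;>
      simp [toAssocGenerator, ofAssocGenerator, h] <;> rfl

variable (R : Type*) [Ring R]

/-- The homomorphism of free `R`-rings induced by `toAssocGenerator`. -/
noncomputable def freeToAssoc : E.FreeRing R →ₙ+* E.assoc.FreeRing R :=
  MonoidAlgebra.mapDomainNonUnitalRingHom R (FreeSemigroup.map toAssocGenerator)

/-- The homomorphism of free `R`-rings induced by `ofAssocGenerator`. -/
noncomputable def freeOfAssoc : E.assoc.FreeRing R →ₙ+* E.FreeRing R :=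
  MonoidAlgebra.mapDomainNonUnitalRingHom R (FreeSemigroup.map ofAssocGenerator)

end WeightedGraph

section MapDomain

variable {R : Type*} [Ring R] {X Y : Type*}

theorem mapDomainNonUnitalRingHom_single' (f : X → Y) (w : FreeSemigroup X) (a : R) :
    MonoidAlgebra.mapDomainNonUnitalRingHom R (FreeSemigroup.map f) (MonoidAlgebra.single w a) =
      MonoidAlgebra.single (FreeSemigroup.map f w) a :=
  MonoidAlgebra.mapDomain_single

theorem mapDomainNonUnitalRingHom_smul' (f : X → Y) (a : R)
    (x : MonoidAlgebra R (FreeSemigroup X)) :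
    MonoidAlgebra.mapDomainNonUnitalRingHom R (FreeSemigroup.map f) (a • x) =
      a • MonoidAlgebra.mapDomainNonUnitalRingHom R (FreeSemigroup.map f) x := by
  induction x using MonoidAlgebra.induction_linear with
  | zero => simp only [smul_zero, map_zero]
  | add x y hx hy => simp only [smul_add, map_add, hx, hy]
  | single w b => simp only [MonoidAlgebra.smul_single, mapDomainNonUnitalRingHom_single']

theorem mapDomainNonUnitalRingHom_op_smul' (f : X → Y) (a : R)
    (x : MonoidAlgebra R (FreeSemigroup X)) :
    MonoidAlgebra.mapDomainNonUnitalRingHom R (FreeSemigroup.map f) (MulOpposite.op a • x) =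
      MulOpposite.op a • MonoidAlgebra.mapDomainNonUnitalRingHom R (FreeSemigroup.map f) x := by
  induction x using MonoidAlgebra.induction_linear with
  | zero => simp only [smul_zero, map_zero]
  | add x y hx hy => simp only [smul_add, map_add, hx, hy]
  | single w b => simp only [MonoidAlgebra.smul_single, mapDomainNonUnitalRingHom_single']

theorem mapDomainNonUnitalRingHom_leftInverse' {f : X → Y} {g : Y → X}
    (h : Function.LeftInverse g f) (x : MonoidAlgebra R (FreeSemigroup X)) :
    MonoidAlgebra.mapDomainNonUnitalRingHom R (FreeSemigroup.map g)
      (MonoidAlgebra.mapDomainNonUnitalRingHom R (FreeSemigroup.map f) x) = x := by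
  have hw : ∀ w, FreeSemigroup.map g (FreeSemigroup.map f w) = w := by
    intro w
    induction w using FreeSemigroup.recOnMul with
    | ih1 y => simp [FreeSemigroup.map_of, h y]
    | ih2 y w hy hw => rw [map_mul, map_mul, hy, hw]
  induction x using MonoidAlgebra.induction_linear with
  | zero => simp only [map_zero]
  | add x y hx hy => simp only [map_add, hx, hy]
  | single w b => simp only [mapDomainNonUnitalRingHom_single', hw]

end MapDomain

/-! ### The isomorphism for reducible graphs -/

namespace WeightedLeavittPathAlgebra

open WeightedGraph

variable {V S : Type*} (R : Type*) [Ring R] {E : WeightedGraph V S}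

/-- The homomorphism from the free `R`-ring on `E` to the Leavitt path algebra of the associated
graph. -/
noncomputable def preToAssoc : E.FreeRing R →ₙ+* WeightedLeavittPathAlgebra R E.assoc :=
  (mkHom R E.assoc).comp (freeToAssoc R)

/-- The homomorphism from the free `R`-ring on the associated graph to the weighted Leavitt path
algebra. -/
noncomputable def preOfAssoc : E.assoc.FreeRing R →ₙ+* WeightedLeavittPathAlgebra R E :=
  (mkHom R E).comp (freeOfAssoc R)

variable {R}

theorem preToAssoc_apply (x : E.FreeRing R) : preToAssoc R x = mk R E.assoc (freeToAssoc R x) := rfl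

theorem preOfAssoc_apply (x : E.assoc.FreeRing R) :
    preOfAssoc R x = mk R E (freeOfAssoc R x) := rfl

theorem preToAssoc_single (g : E.Generator) :
    preToAssoc R (MonoidAlgebra.single (FreeSemigroup.of g) 1) =
      mk R E.assoc (MonoidAlgebra.single (FreeSemigroup.of (toAssocGenerator g)) 1) := by
  rw [preToAssoc_apply, freeToAssoc, mapDomainNonUnitalRingHom_single', FreeSemigroup.map_of]

theorem preOfAssoc_single (g : E.assoc.Generator) :
    preOfAssoc R (MonoidAlgebra.single (FreeSemigroup.of g) 1) =
      mk R E (MonoidAlgebra.single (FreeSemigroup.of (ofAssocGenerator g)) 1) := by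
  rw [preOfAssoc_apply, freeOfAssoc, mapDomainNonUnitalRingHom_single', FreeSemigroup.map_of]

theorem preToAssoc_vertexElt (v : V) :
    preToAssoc R (E.vertexElt R v) = vertex R E.assoc v := preToAssoc_single _

theorem preOfAssoc_vertexElt (v : V) :
    preOfAssoc R (E.assoc.vertexElt R v) = vertex R E v := preOfAssoc_single _

theorem assoc_weight_pos (e : E.Edge) : 0 < E.assoc.weight e := one_pos

theorem preToAssoc_edgeElt_of_mem {α : S} (hα : E.source α ∈ E.weightForest) {i : ℕ}
    (h : i < E.weight α) : preToAssoc R (E.edgeElt R α i) = ghost R E.assoc ⟨α, ⟨i, h⟩⟩ 0 := by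
  rw [edgeElt, dif_pos h, preToAssoc_single, toAssocGenerator, if_pos hα, ghost, ghostElt,
    dif_pos (assoc_weight_pos _)]

theorem preToAssoc_edgeElt_of_notMem {α : S} (hα : E.source α ∉ E.weightForest) {i : ℕ}
    (h : i < E.weight α) : preToAssoc R (E.edgeElt R α i) = edge R E.assoc ⟨α, ⟨i, h⟩⟩ 0 := by
  rw [edgeElt, dif_pos h, preToAssoc_single, toAssocGenerator, if_neg hα, edge, edgeElt,
    dif_pos (assoc_weight_pos _)]

theorem preToAssoc_ghostElt_of_mem {α : S} (hα : E.source α ∈ E.weightForest) {i : ℕ}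
    (h : i < E.weight α) : preToAssoc R (E.ghostElt R α i) = edge R E.assoc ⟨α, ⟨i, h⟩⟩ 0 := by
  rw [ghostElt, dif_pos h, preToAssoc_single, toAssocGenerator, if_pos hα, edge, edgeElt,
    dif_pos (assoc_weight_pos _)]

theorem preToAssoc_ghostElt_of_notMem {α : S} (hα : E.source α ∉ E.weightForest) {i : ℕ}
    (h : i < E.weight α) : preToAssoc R (E.ghostElt R α i) = ghost R E.assoc ⟨α, ⟨i, h⟩⟩ 0 := by
  rw [ghostElt, dif_pos h, preToAssoc_single, toAssocGenerator, if_neg hα, ghost, ghostElt,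
    dif_pos (assoc_weight_pos _)]

theorem preOfAssoc_edgeElt_of_mem {e : E.Edge} (he : E.source e.1 ∈ E.weightForest) :
    preOfAssoc R (E.assoc.edgeElt R e 0) = ghost R E e.1 e.2 := by
  rw [edgeElt, dif_pos (assoc_weight_pos _), preOfAssoc_single, ofAssocGenerator, if_pos he, ghost,
    ghostElt, dif_pos e.2.2]

theorem preOfAssoc_edgeElt_of_notMem {e : E.Edge} (he : E.source e.1 ∉ E.weightForest) :
    preOfAssoc R (E.assoc.edgeElt R e 0) = edge R E e.1 e.2 := by
  rw [edgeElt, dif_pos (assoc_weight_pos _), preOfAssoc_single, ofAssocGenerator, if_neg he, edge,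
    edgeElt, dif_pos e.2.2]

theorem preOfAssoc_ghostElt_of_mem {e : E.Edge} (he : E.source e.1 ∈ E.weightForest) :
    preOfAssoc R (E.assoc.ghostElt R e 0) = edge R E e.1 e.2 := by
  rw [ghostElt, dif_pos (assoc_weight_pos _), preOfAssoc_single, ofAssocGenerator, if_pos he, edge,
    edgeElt, dif_pos e.2.2]

theorem preOfAssoc_ghostElt_of_notMem {e : E.Edge} (he : E.source e.1 ∉ E.weightForest) :
    preOfAssoc R (E.assoc.ghostElt R e 0) = ghost R E e.1 e.2 := by
  rw [ghostElt, dif_pos (assoc_weight_pos _), preOfAssoc_single, ofAssocGenerator, if_neg he, ghost,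
    ghostElt, dif_pos e.2.2]

theorem source_mul_preToAssoc_edgeElt (α : S) (i : ℕ) (h : i < E.weight α) :
    vertex R E.assoc (E.source α) * preToAssoc R (E.edgeElt R α i) =
      preToAssoc R (E.edgeElt R α i) := by
  by_cases hα : E.source α ∈ E.weightForest
  · rw [preToAssoc_edgeElt_of_mem hα h, ← assoc_range_of_mem (e := ⟨α, ⟨i, h⟩⟩) hα,
      range_mul_ghost]
  · rw [preToAssoc_edgeElt_of_notMem hα h, ← assoc_source_of_notMem (e := ⟨α, ⟨i, h⟩⟩) hα,
      source_mul_edge]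

theorem preToAssoc_edgeElt_mul_range (α : S) (i : ℕ) (h : i < E.weight α) :
    preToAssoc R (E.edgeElt R α i) * vertex R E.assoc (E.range α) =
      preToAssoc R (E.edgeElt R α i) := by
  by_cases hα : E.source α ∈ E.weightForest
  · rw [preToAssoc_edgeElt_of_mem hα h, ← assoc_source_of_mem (e := ⟨α, ⟨i, h⟩⟩) hα,
      ghost_mul_source]
  · rw [preToAssoc_edgeElt_of_notMem hα h, ← assoc_range_of_notMem (e := ⟨α, ⟨i, h⟩⟩) hα,
      edge_mul_range]

theorem range_mul_preToAssoc_ghostElt (α : S) (i : ℕ) (h : i < E.weight α) :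
    vertex R E.assoc (E.range α) * preToAssoc R (E.ghostElt R α i) =
      preToAssoc R (E.ghostElt R α i) := by
  by_cases hα : E.source α ∈ E.weightForest
  · rw [preToAssoc_ghostElt_of_mem hα h, ← assoc_source_of_mem (e := ⟨α, ⟨i, h⟩⟩) hα,
      source_mul_edge]
  · rw [preToAssoc_ghostElt_of_notMem hα h, ← assoc_range_of_notMem (e := ⟨α, ⟨i, h⟩⟩) hα,
      range_mul_ghost]

theorem preToAssoc_ghostElt_mul_source (α : S) (i : ℕ) (h : i < E.weight α) :
    preToAssoc R (E.ghostElt R α i) * vertex R E.assoc (E.source α) =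
      preToAssoc R (E.ghostElt R α i) := by
  by_cases hα : E.source α ∈ E.weightForest
  · rw [preToAssoc_ghostElt_of_mem hα h, ← assoc_range_of_mem (e := ⟨α, ⟨i, h⟩⟩) hα,
      edge_mul_range]
  · rw [preToAssoc_ghostElt_of_notMem hα h, ← assoc_source_of_notMem (e := ⟨α, ⟨i, h⟩⟩) hα,
      ghost_mul_source]

theorem preToAssoc_rel (hr : E.Reducible) (hE : E.RowFinite) {x y : E.FreeRing R}
    (h : E.LeavittRel R x y) : preToAssoc R x = preToAssoc R y := by
  cases h with
  | vertex_mul_self v => rw [map_mul, preToAssoc_vertexElt, vertex_mul_self]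
  | vertex_mul_of_ne v w h =>
    rw [map_mul, preToAssoc_vertexElt, preToAssoc_vertexElt, vertex_mul_vertex_of_ne h, map_zero]
  | source_mul_edge α i h =>
    rw [map_mul, preToAssoc_vertexElt, source_mul_preToAssoc_edgeElt α i h]
  | edge_mul_range α i h =>
    rw [map_mul, preToAssoc_vertexElt, preToAssoc_edgeElt_mul_range α i h]
  | range_mul_ghost α i h =>
    rw [map_mul, preToAssoc_vertexElt, range_mul_preToAssoc_ghostElt α i h]
  | ghost_mul_source α i h =>
    rw [map_mul, preToAssoc_vertexElt, preToAssoc_ghostElt_mul_source α i h]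
  | sum_edge_ghost v hv i j hi hj =>
    have hrhs : preToAssoc R (if i = j then E.vertexElt R v else 0) =
        if i = j then vertex R E.assoc v else 0 := by
      split_ifs
      · exact preToAssoc_vertexElt v
      · exact map_zero _
    rw [hrhs, map_sum]
    by_cases hvf : v ∈ E.weightForest
    · obtain ⟨α, rfl, hi⟩ := hi
      obtain ⟨β, hβ, hj⟩ := hj
      obtain rfl := hr.eq_of_source_eq hvf hβ
      have : hv.toFinset = {β} := by
        ext γ
        simpa using ⟨fun h => hr.eq_of_source_eq hvf h, fun h => h ▸ rfl⟩
      rw [this, Finset.sum_singleton, map_mul, preToAssoc_edgeElt_of_mem hvf hi,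
        preToAssoc_ghostElt_of_mem hvf hj]
      by_cases hij : i = j
      · subst hij
        rw [if_pos rfl, ghost_mul_edge_self_of_weight rfl, assoc_range_of_mem hvf]
      · rw [if_neg hij, ghost_mul_edge_of_ne_of_weight _ rfl rfl]
        simpa using hij
    · have hw : ∀ α, E.source α = v → E.weight α = 1 := fun α hα =>
        weight_eq_one_of_source_notMem (hα ▸ hvf)
      obtain ⟨α, hα, hi⟩ := hi
      obtain ⟨β, hβ, hj⟩ := hj
      obtain rfl : i = 0 := by rwa [hw α hα, Nat.lt_one_iff] at hi
      obtain rfl : j = 0 := by rwa [hw β hβ, Nat.lt_one_iff] at hj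
      have hfin := hr.rowFinite_assoc hE v
      have hα' : E.assoc.source ⟨α, ⟨0, E.weight_pos α⟩⟩ = v :=
        (assoc_source_eq_iff_of_notMem hvf _).2 hα
      rw [← sum_edge_mul_ghost (R := R) hfin ⟨_, hα', one_pos⟩ ⟨_, hα', one_pos⟩]
      refine Finset.sum_nbij (fun γ => ⟨γ, ⟨0, E.weight_pos γ⟩⟩) ?_ ?_ ?_ ?_
      · intro γ hγ
        rw [Set.Finite.mem_toFinset] at hγ ⊢
        exact (assoc_source_eq_iff_of_notMem hvf _).2 hγ
      · intro γ _ δ _ h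
        exact congrArg Sigma.fst h
      · rintro ⟨γ, k⟩ he
        have hγ : E.source γ = v := (assoc_source_eq_iff_of_notMem hvf ⟨γ, k⟩).1 (by simpa using he)
        refine ⟨γ, by simpa using hγ, Sigma.ext rfl (heq_of_eq (Fin.ext ?_))⟩
        exact (coe_snd_eq_zero_of_source_notMem (hγ ▸ hvf) k).symm
      · intro γ hγ
        have hγ' : E.source γ ∉ E.weightForest := by
          rw [Set.Finite.mem_toFinset] at hγ
          exact fun h => hvf (hγ ▸ h)
        rw [map_mul, preToAssoc_edgeElt_of_notMem hγ' (E.weight_pos γ),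
          preToAssoc_ghostElt_of_notMem hγ' (E.weight_pos γ)]
  | sum_ghost_edge_self α =>
    rw [map_sum, preToAssoc_vertexElt]
    by_cases hα : E.source α ∈ E.weightForest
    · have hfin := hr.rowFinite_assoc hE (E.range α)
      have hα' : E.assoc.source ⟨α, ⟨0, E.weight_pos α⟩⟩ = E.range α := assoc_source_of_mem hα
      have := sum_edge_mul_ghost (R := R) hfin ⟨_, hα', one_pos⟩ ⟨_, hα', one_pos⟩
      rw [if_pos rfl] at this
      rw [← this, Finset.sum_range]
      refine Finset.sum_nbij (fun k => ⟨α, k⟩) ?_ ?_ ?_ ?_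
      · intro k _
        rw [Set.Finite.mem_toFinset]
        exact assoc_source_of_mem hα
      · intro k _ l _ h
        simpa using h
      · rintro ⟨γ, k⟩ he
        obtain ⟨h1, h2⟩ := (assoc_source_eq_iff_of_mem (range_mem_weightForest hα) ⟨γ, k⟩).1
          (by simpa using he)
        obtain rfl : γ = α := hr.eq_of_range_eq hα h2 h1
        exact ⟨k, by simp, rfl⟩
      · intro k _
        rw [map_mul, preToAssoc_edgeElt_of_mem hα k.2, preToAssoc_ghostElt_of_mem hα k.2]
    · rw [weight_eq_one_of_source_notMem hα, Finset.sum_range_one, map_mul,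
        preToAssoc_edgeElt_of_notMem hα (E.weight_pos α),
        preToAssoc_ghostElt_of_notMem hα (E.weight_pos α), ghost_mul_edge_self_of_weight rfl,
        assoc_range_of_notMem hα]
  | sum_ghost_edge_of_ne α β hne =>
    rw [map_sum, map_zero]
    refine Finset.sum_eq_zero fun i _ => ?_
    rw [map_mul]
    -- The sum vanishes term by term. Different sources give orthogonal vertices between the two
    -- factors; edges with a common source lie outside the forest by reducibility, and there the
    -- term is an orthogonality relation of `F`.
    by_cases hi : i < E.weight α
    · by_cases hj : i < E.weight β
      · by_cases hs : E.source α = E.source β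
        · have hβ : E.source β ∉ E.weightForest := fun h => hne (hr.eq_of_source_eq h hs)
          rw [preToAssoc_ghostElt_of_notMem (hs ▸ hβ) hi, preToAssoc_edgeElt_of_notMem hβ hj]
          exact ghost_mul_edge_of_ne_of_weight (fun h => hne (congrArg Sigma.fst h)) rfl rfl
        · exact mul_eq_zero_of_vertex hs (preToAssoc_ghostElt_mul_source α i hi)
            (source_mul_preToAssoc_edgeElt β i hj)
      · rw [edgeElt, dif_neg hj, map_zero, mul_zero]
    · rw [ghostElt, dif_neg hi, map_zero, zero_mul]

theorem preOfAssoc_rel (hr : E.Reducible) (hE : E.RowFinite) {x y : E.assoc.FreeRing R}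
    (h : E.assoc.LeavittRel R x y) : preOfAssoc R x = preOfAssoc R y := by
  cases h with
  | vertex_mul_self v => rw [map_mul, preOfAssoc_vertexElt, vertex_mul_self]
  | vertex_mul_of_ne v w h =>
    rw [map_mul, preOfAssoc_vertexElt, preOfAssoc_vertexElt, vertex_mul_vertex_of_ne h, map_zero]
  | source_mul_edge e i h =>
    obtain rfl : i = 0 := Nat.lt_one_iff.1 h
    rw [map_mul, preOfAssoc_vertexElt]
    by_cases he : E.source e.1 ∈ E.weightForest
    · rw [preOfAssoc_edgeElt_of_mem he, assoc_source_of_mem he, range_mul_ghost]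
    · rw [preOfAssoc_edgeElt_of_notMem he, assoc_source_of_notMem he, source_mul_edge]
  | edge_mul_range e i h =>
    obtain rfl : i = 0 := Nat.lt_one_iff.1 h
    rw [map_mul, preOfAssoc_vertexElt]
    by_cases he : E.source e.1 ∈ E.weightForest
    · rw [preOfAssoc_edgeElt_of_mem he, assoc_range_of_mem he, ghost_mul_source]
    · rw [preOfAssoc_edgeElt_of_notMem he, assoc_range_of_notMem he, edge_mul_range]
  | range_mul_ghost e i h =>
    obtain rfl : i = 0 := Nat.lt_one_iff.1 h
    rw [map_mul, preOfAssoc_vertexElt]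
    by_cases he : E.source e.1 ∈ E.weightForest
    · rw [preOfAssoc_ghostElt_of_mem he, assoc_range_of_mem he, source_mul_edge]
    · rw [preOfAssoc_ghostElt_of_notMem he, assoc_range_of_notMem he, range_mul_ghost]
  | ghost_mul_source e i h =>
    obtain rfl : i = 0 := Nat.lt_one_iff.1 h
    rw [map_mul, preOfAssoc_vertexElt]
    by_cases he : E.source e.1 ∈ E.weightForest
    · rw [preOfAssoc_ghostElt_of_mem he, assoc_source_of_mem he, edge_mul_range]
    · rw [preOfAssoc_ghostElt_of_notMem he, assoc_source_of_notMem he, ghost_mul_source]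
  | sum_edge_ghost v hv i j hi hj =>
    obtain ⟨e, he, hi⟩ := hi
    obtain ⟨_, -, hj⟩ := hj
    obtain rfl : i = 0 := Nat.lt_one_iff.1 hi
    obtain rfl : j = 0 := Nat.lt_one_iff.1 hj
    rw [if_pos rfl, map_sum, preOfAssoc_vertexElt]
    by_cases hvf : v ∈ E.weightForest
    -- The edges of `F` leaving `v` are exactly the copies of the unique forest edge ending in `v`,
    -- so the sum becomes relation 4 for that edge.
    · obtain ⟨rfl, heF⟩ := (assoc_source_eq_iff_of_mem hvf e).1 he
      rw [← sum_ghost_mul_edge, Finset.sum_range]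
      symm
      refine Finset.sum_nbij (fun k => ⟨e.1, k⟩) ?_ ?_ ?_ ?_
      · intro k _
        rw [Set.Finite.mem_toFinset]
        exact assoc_source_of_mem heF
      · intro k _ l _ h
        simpa using h
      · rintro ⟨γ, k⟩ hγ
        obtain ⟨h1, h2⟩ := (assoc_source_eq_iff_of_mem hvf ⟨γ, k⟩).1 (by simpa using hγ)
        obtain rfl : γ = e.1 := hr.eq_of_range_eq heF h2 h1
        exact ⟨k, by simp, rfl⟩
      · intro k _
        rw [map_mul, preOfAssoc_edgeElt_of_mem (e := ⟨e.1, k⟩) heF,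
          preOfAssoc_ghostElt_of_mem (e := ⟨e.1, k⟩) heF]
    · have heS := (assoc_source_eq_iff_of_notMem hvf e).1 he
      have := sum_edge_mul_ghost (R := R) (hE v) ⟨_, heS, E.weight_pos _⟩ ⟨_, heS, E.weight_pos _⟩
      rw [if_pos rfl] at this
      rw [← this]
      symm
      refine Finset.sum_nbij (fun γ => ⟨γ, ⟨0, E.weight_pos γ⟩⟩) ?_ ?_ ?_ ?_
      · intro γ hγ
        rw [Set.Finite.mem_toFinset] at hγ ⊢
        exact (assoc_source_eq_iff_of_notMem hvf _).2 hγ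
      · intro γ _ δ _ h
        exact congrArg Sigma.fst h
      · rintro ⟨γ, k⟩ he
        have hγ : E.source γ = v := (assoc_source_eq_iff_of_notMem hvf ⟨γ, k⟩).1 (by simpa using he)
        refine ⟨γ, by simpa using hγ, Sigma.ext rfl (heq_of_eq (Fin.ext ?_))⟩
        exact (coe_snd_eq_zero_of_source_notMem (hγ ▸ hvf) k).symm
      · intro γ hγ
        have hγ' : E.source γ ∉ E.weightForest := by
          rw [Set.Finite.mem_toFinset] at hγ
          exact fun h => hvf (hγ ▸ h)
        rw [map_mul, preOfAssoc_edgeElt_of_notMem (e := ⟨γ, ⟨0, E.weight_pos γ⟩⟩) hγ',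
          preOfAssoc_ghostElt_of_notMem (e := ⟨γ, ⟨0, E.weight_pos γ⟩⟩) hγ']
  | sum_ghost_edge_self e =>
    rw [show E.assoc.weight e = 1 from rfl, Finset.sum_range_one, map_mul, preOfAssoc_vertexElt]
    by_cases he : E.source e.1 ∈ E.weightForest
    · rw [preOfAssoc_edgeElt_of_mem he, preOfAssoc_ghostElt_of_mem he, assoc_range_of_mem he,
        edge_mul_ghost_of_unique (fun β => hr.eq_of_source_eq he) e.2.2 e.2.2, if_pos rfl]
    · have hw := weight_eq_one_of_source_notMem he
      have h0 := coe_snd_eq_zero_of_source_notMem he e.2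
      rw [preOfAssoc_edgeElt_of_notMem he, preOfAssoc_ghostElt_of_notMem he,
        assoc_range_of_notMem he, h0, ghost_mul_edge_self_of_weight hw]
  | sum_ghost_edge_of_ne e f hne =>
    rw [show max (E.assoc.weight e) (E.assoc.weight f) = 1 from rfl, Finset.sum_range_one, map_mul,
      map_zero]
    by_cases he : E.source e.1 ∈ E.weightForest <;> by_cases hf : E.source f.1 ∈ E.weightForest
    · rw [preOfAssoc_ghostElt_of_mem he, preOfAssoc_edgeElt_of_mem hf]
      by_cases hrg : E.range f.1 = E.range e.1
      · obtain ⟨α, i⟩ := e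
        obtain ⟨β, j⟩ := f
        obtain rfl : β = α := hr.eq_of_range_eq he hf hrg
        rw [edge_mul_ghost_of_unique (fun γ => hr.eq_of_source_eq he) i.2 j.2, if_neg]
        exact fun h => hne (Sigma.ext rfl (heq_of_eq (Fin.ext h)))
      · exact mul_eq_zero_of_vertex (Ne.symm hrg) (edge_mul_range _ _) (range_mul_ghost _ _)
    -- In the two mixed cases one of the vertices that meet is the range of a forest edge, hence in
    -- the forest, while the other is a source outside it.
    · rw [preOfAssoc_ghostElt_of_mem he, preOfAssoc_edgeElt_of_notMem hf]
      exact mul_eq_zero_of_vertex (fun h => hf (h.subst (range_mem_weightForest he)))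
        (edge_mul_range _ _) (source_mul_edge _ _)
    · rw [preOfAssoc_ghostElt_of_notMem he, preOfAssoc_edgeElt_of_mem hf]
      exact mul_eq_zero_of_vertex (fun h => he (h.symm.subst (range_mem_weightForest hf)))
        (ghost_mul_source _ _) (range_mul_ghost _ _)
    · obtain ⟨α, i⟩ := e
      obtain ⟨β, j⟩ := f
      have hα := weight_eq_one_of_source_notMem he
      have hβ := weight_eq_one_of_source_notMem hf
      obtain rfl : i = ⟨0, E.weight_pos α⟩ := Fin.ext (coe_snd_eq_zero_of_source_notMem he i)
      obtain rfl : j = ⟨0, E.weight_pos β⟩ := Fin.ext (coe_snd_eq_zero_of_source_notMem hf j)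
      rw [preOfAssoc_ghostElt_of_notMem he, preOfAssoc_edgeElt_of_notMem hf]
      refine ghost_mul_edge_of_ne_of_weight (fun h : α = β => hne ?_) hα hβ
      subst h
      rfl

/-- The weighted Leavitt path algebra of a reducible row-finite weighted graph is isomorphic to the
Leavitt path algebra of the associated graph. -/
theorem exists_ringEquiv_of_reducible (R : Type*) [Ring R] (hr : E.Reducible) (hE : E.RowFinite) :
    ∃ φ : WeightedLeavittPathAlgebra R E ≃+* LeavittPathAlgebra R E.associatedGraph,
      (∀ (a : R) x, φ (a • x) = a • φ x) ∧
      (∀ (a : R) x, φ (MulOpposite.op a • x) = MulOpposite.op a • φ x) := by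
  have hs : ∀ (a : R) x, preToAssoc R (E := E) (a • x) = a • preToAssoc R x := fun a x => by
    rw [preToAssoc_apply, freeToAssoc, mapDomainNonUnitalRingHom_smul']; rfl
  have hs' : ∀ (a : R) x, preToAssoc R (E := E) (MulOpposite.op a • x) =
      MulOpposite.op a • preToAssoc R x := fun a x => by
    rw [preToAssoc_apply, freeToAssoc, mapDomainNonUnitalRingHom_op_smul']; rfl
  have ht : ∀ (a : R) x, preOfAssoc R (E := E) (a • x) = a • preOfAssoc R x := fun a x => by
    rw [preOfAssoc_apply, freeOfAssoc, mapDomainNonUnitalRingHom_smul']; rfl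
  have ht' : ∀ (a : R) x, preOfAssoc R (E := E) (MulOpposite.op a • x) =
      MulOpposite.op a • preOfAssoc R x := fun a x => by
    rw [preOfAssoc_apply, freeOfAssoc, mapDomainNonUnitalRingHom_op_smul']; rfl
  -- The two substitutions are mutually inverse on the generators, hence on the free rings, so the
  -- induced maps are inverse to each other once both respect the relations.
  let φ := lift (preToAssoc R (E := E))
    (fun a x hx => ⟨by rw [hs, hx, smul_zero], by rw [hs', hx, smul_zero]⟩)
    (fun _ _ => preToAssoc_rel hr hE)
  let χ := lift (preOfAssoc R (E := E))
    (fun a x hx => ⟨by rw [ht, hx, smul_zero], by rw [ht', hx, smul_zero]⟩)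
    (fun _ _ => preOfAssoc_rel hr hE)
  refine ⟨{ φ with
    invFun := χ
    left_inv := ?_
    right_inv := ?_ }, ?_, ?_⟩
  · intro x
    obtain ⟨x, rfl⟩ := mk_surjective x
    exact congrArg (mk R E)
      (mapDomainNonUnitalRingHom_leftInverse' ofAssocGenerator_toAssocGenerator x)
  · intro x
    obtain ⟨x, rfl⟩ := mk_surjective x
    exact congrArg (mk R E.assoc)
      (mapDomainNonUnitalRingHom_leftInverse' toAssocGenerator_ofAssocGenerator x)
  · intro a x
    obtain ⟨x, rfl⟩ := mk_surjective x
    exact hs a x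
  · intro a x
    obtain ⟨x, rfl⟩ := mk_surjective x
    exact hs' a x

end WeightedLeavittPathAlgebra

theorem isSimpleRing_iff_of_ringEquiv {A B : Type*} [NonUnitalRing A] [NonUnitalRing B]
    (φ : A ≃+* B) : IsSimpleRing A ↔ IsSimpleRing B := by
  rw [isSimpleRing_iff, isSimpleRing_iff]
  exact φ.mapTwoSidedIdeal.isSimpleOrder_iff

theorem mainTheorem2 {V S : Type*} [Countable V] [Countable S] (R : Type*) [Ring R]
    (E : WeightedGraph V S) (hE : E.RowFinite) :
    (IsSimpleRing (WeightedLeavittPathAlgebra R E) ↔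
      E.Reducible ∧ IsSimpleRing (LeavittPathAlgebra R E.associatedGraph)) ∧
    (IsSimpleRing (WeightedLeavittPathAlgebra R E) →
      E.associatedGraph.toWeightedGraph.RowFinite ∧
      ∃ φ : WeightedLeavittPathAlgebra R E ≃+* LeavittPathAlgebra R E.associatedGraph,
        (∀ (a : R) x, φ (a • x) = a • φ x) ∧
        (∀ (a : R) x, φ (MulOpposite.op a • x) = MulOpposite.op a • φ x)) := by
  refine ⟨⟨fun h => ?_, fun ⟨hr, h⟩ => ?_⟩, fun h => ?_⟩
  · have hr := WeightedGraph.reducible_of_isSimpleRing h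
    obtain ⟨φ, -⟩ := WeightedLeavittPathAlgebra.exists_ringEquiv_of_reducible R hr hE
    exact ⟨hr, (isSimpleRing_iff_of_ringEquiv φ).1 h⟩
  · obtain ⟨φ, -⟩ := WeightedLeavittPathAlgebra.exists_ringEquiv_of_reducible R hr hE
    exact (isSimpleRing_iff_of_ringEquiv φ).2 h
  · have hr := WeightedGraph.reducible_of_isSimpleRing h
    exact ⟨hr.rowFinite_assoc hE,
      WeightedLeavittPathAlgebra.exists_ringEquiv_of_reducible R hr hE⟩
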